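/- For each $N\ge 1$ let $E_N$ be a countable set and let $R_N:E_N\times E_N\to\mathbb R$ satisfy $R_N(\eta,\xi)\ge 0$ for $\eta\ne\xi$, $-\infty<R_N(\eta,\eta)\le 0$ and $\sum_{\xi}R_N(\eta,\xi)=0$ for every $\eta$. Let $\{\eta^N_t:t\ge 0\}$ be the minimal right-continuous Markov process on $E_N$ with jump rates $R_N$, assume that it does not explode, and write $\mathbf P_\eta$, $\mathbf E_\eta$ for its law and expectation when it starts from $\eta$. For $A,F\subseteq E_N$ put $$T_A=\inf\{s>0:\eta^N_s\in A\}\in[0,\infty],\qquad T_A(F)=\int_0^{T_A}\mathbf 1\{\eta^N_s\in F\}\,ds .$$ Let $W_N\subseteq B_N\subsetneq E_N$, $\Delta_N=B_N\setminus W_N$, $\xi_N\in W_N$. A point of $\mathcal W$ is a sequence $(\eta_N)$ with $\eta_N\in W_N$ for all $N$. For a sequence $\theta=(\theta_N)$ of positive real numbers, the triple $(\mathcal W,\mathcal B,\xi)=((W_N),(B_N),(\xi_N))$ is called a valley of depth $\theta$ (and attractor $\xi$) if for every point $(\eta_N)$ of $\mathcal W$: (V1) $\lim_{N}\mathbf P_{\eta_N}[T_{\{\xi_N\}}<T_{B_N^c}]=1$;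 (V2) the law of $T_{B_N^c}/\theta_N$ under $\mathbf P_{\eta_N}$ converges weakly to the mean-one exponential distribution; (V3) $\lim_N\mathbf P_{\eta_N}[T_{B_N^c}(\Delta_N)/\theta_N>\delta]=0$ for every $\delta>0$. For a point $(\eta_N)$ of $\mathcal W$ consider the following conditions, in which it is understood that $\mathbf E_{\eta_N}[T_{B_N^c}(W_N)]$ and $\mathbf E_{\eta_N}[T_{\{\xi_N\}}(W_N)]$ are finite for all sufficiently large $N$: (i) $\displaystyle\lim_{N}\frac{\mathbf E_{\eta_N}[T_{\{\xi_N\}}(W_N)]}{\mathbf E_{\eta_N}[T_{B_N^c}(W_N)]}=0$; (ii) the law of $T_{B_N^c}(W_N)/\mathbf E_{\eta_N}[T_{B_N^c}(W_N)]$ under $\mathbf P_{\eta_N}$ converges weakly to the mean-one exponential distribution; (iii) $\displaystyle\lim_N\mathbf P_{\eta_N}\Big[\frac{T_{B_N^c}(\Delta_N)}{\mathbf E_{\eta_N}[T_{B_N^c}(W_N)]}>\delta\Big]=0$ for every $\delta>0$. **Proposition.** (a) If $(\mathcal W,\mathcal B,\xi)$ is a valley of depth $\theta$, then every point $(\eta_N)$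 of $\mathcal W$ satisfies (i)–(iii) (including the finiteness of the expectations for large $N$), and $\lim_N\theta_N^{-1}\mathbf E_{\eta_N}[T_{B_N^c}(W_N)]=1$. (b) Conversely, if every point of $\mathcal W$ satisfies (i)–(iii), then for every point $(\eta_N)$ of $\mathcal W$ $$\lim_{N}\frac{\mathbf E_{\eta_N}[T_{B_N^c}(W_N)]}{\mathbf E_{\xi_N}[T_{B_N^c}(W_N)]}=1,$$ and $(\mathcal W,\mathcal B,\xi)$ is a valley of depth $\theta$ for $\theta_N=\mathbf E_{\xi_N}[T_{B_N^c}(W_N)]$, that is, for every sequence of positive numbers $\theta_N$ that equals this expectation for all sufficiently large $N$. -/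

import Mathlib

open MeasureTheory ProbabilityTheory Filter Topology
open scoped ENNReal

noncomputable section

namespace Valley

/-- A conservative matrix of jump rates on `E`: nonnegative off the diagonal, nonpositive (finite)
on the diagonal, with rows summing to zero. -/
structure RateMatrix (E : Type*) where
  rate : E → E → ℝ
  rate_nonneg : ∀ η ξ, η ≠ ξ → 0 ≤ rate η ξ
  rate_diag_nonpos : ∀ η, rate η η ≤ 0
  hasSum_rate : ∀ η, HasSum (rate η) 0

instance isProbabilityMeasure_expMeasure_one : IsProbabilityMeasure (expMeasure 1) :=
  isProbabilityMeasure_expMeasure one_pos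

namespace RateMatrix

variable {E : Type*} (R : RateMatrix E)

/-- The holding rate `λ(η) = -R(η, η)`. -/
def holdingRate (η : E) : ℝ := -R.rate η η

open Classical in
/-- The jump probabilities `p(η, ·)`: `p(η, ξ) = R(η, ξ) / λ(η)` for `ξ ≠ η` and `p(η, η) = 0` if
`λ(η) ≠ 0`; `p(η, ·) = δ_η` if `η` is absorbing, i.e. `λ(η) = 0`. -/
def jumpProb (η ξ : E) : ℝ :=
  if R.holdingRate η = 0 then (if ξ = η then 1 else 0)
  else (if ξ = η then 0 else R.rate η ξ / R.holdingRate η)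

lemma jumpProb_nonneg (η ξ : E) : 0 ≤ R.jumpProb η ξ := by
  unfold jumpProb
  have h0 : 0 ≤ R.holdingRate η := by
    have := R.rate_diag_nonpos η
    unfold holdingRate
    linarith
  split_ifs with h1 h2 h2
  · exact zero_le_one
  · exact le_rfl
  · exact le_rfl
  · exact div_nonneg (R.rate_nonneg η ξ (Ne.symm h2)) h0

lemma hasSum_jumpProb (η : E) : HasSum (R.jumpProb η) 1 := by
  classical
  by_cases h : R.holdingRate η = 0
  · have : R.jumpProb η = fun ξ => if ξ = η then (1 : ℝ) else 0 := by
      funext ξ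
      simp [jumpProb, h]
    rw [this]
    exact hasSum_ite_eq η 1
  · have h1 : HasSum (fun ξ => R.rate η ξ + (if ξ = η then R.holdingRate η else 0))
        (0 + R.holdingRate η) :=
      (R.hasSum_rate η).add (hasSum_ite_eq η _)
    have h2 := h1.div_const (R.holdingRate η)
    rw [zero_add, div_self h] at h2
    have h3 : R.jumpProb η = fun ξ =>
        (R.rate η ξ + (if ξ = η then R.holdingRate η else 0)) / R.holdingRate η := by
      funext ξ
      by_cases hx : ξ = η
      · subst hx
        have h0 : R.rate ξ ξ + R.holdingRate ξ = 0 := by simp [holdingRate]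
        simp [jumpProb, h, h0]
      · simp [jumpProb, h, hx]
    rw [h3]
    exact h2

/-- The jump distribution `p(η, ·)` as a probability mass function. -/
def jumpPMF (η : E) : PMF E :=
  ⟨fun ξ => ENNReal.ofReal (R.jumpProb η ξ), by
    have h := R.hasSum_jumpProb η
    have h' := ENNReal.ofReal_tsum_of_nonneg (R.jumpProb_nonneg η) h.summable
    rw [h.tsum_eq, ENNReal.ofReal_one] at h'
    rw [h']
    exact ENNReal.summable.hasSum⟩

variable [Countable E] [MeasurableSpace E] [DiscreteMeasurableSpace E]

/-- The transition kernel of the embedded jump chain. -/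
def jumpKernel : Kernel E E := Kernel.ofFunOfCountable fun η => (R.jumpPMF η).toMeasure

instance : IsMarkovKernel R.jumpKernel :=
  ⟨fun η => by
    change IsProbabilityMeasure (R.jumpPMF η).toMeasure
    infer_instance⟩

/-- One step of the chain of pairs (state, mean-one exponential clock): the next state is drawn
from the jump kernel at the present state and, independently of everything else, a new mean-one
exponential variable is drawn. -/
def stepKernel : Kernel (E × ℝ) (E × ℝ) :=
  (R.jumpKernel.comap Prod.fst measurable_fst) ×ₖ Kernel.const (E × ℝ) (expMeasure 1)

instance : IsMarkovKernel R.stepKernel := by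
  unfold stepKernel
  infer_instance

/-- `stepKernel` seen as a function of the whole past of the chain. -/
def pastKernel (n : ℕ) : Kernel (Π _ : Finset.Iic n, E × ℝ) (E × ℝ) :=
  R.stepKernel.comap (fun x => x ⟨n, Finset.mem_Iic.2 le_rfl⟩) (measurable_pi_apply _)

instance (n : ℕ) : IsMarkovKernel (R.pastKernel n) := by
  unfold pastKernel
  infer_instance

/-- The law `P_η` of the sequence `(Y_n, u_n)_{n ≥ 0}`, where `Y` is the embedded jump chain
started at `η` and `(u_n)` are i.i.d. mean-one exponential variables independent of `Y`. The
process with rates `R` started at `η` is the path `R.path ω`, where `ω` has law `R.law η`. -/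
def law (η : E) : Measure (ℕ → E × ℝ) :=
  Kernel.trajMeasure (X := fun _ => E × ℝ) ((Measure.dirac η).prod (expMeasure 1)) R.pastKernel

instance (η : E) : IsProbabilityMeasure (R.law η) := by
  unfold law
  infer_instance

end RateMatrix

section Path

variable {E : Type*} (R : RateMatrix E)

/-- The holding time `S_n = u_n / λ(Y_n)` before the `(n+1)`-st jump; it is infinite if `Y_n` is
absorbing. -/
def RateMatrix.holdingTime (ω : ℕ → E × ℝ) (n : ℕ) : ℝ≥0∞ :=
  ENNReal.ofReal (ω n).2 / ENNReal.ofReal (R.holdingRate (ω n).1)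

/-- The right-continuous jump path, at times `t ≥ 0`: it equals `Y_n` for
`S_0 + ⋯ + S_{n-1} ≤ t < S_0 + ⋯ + S_n`. -/
def RateMatrix.path (ω : ℕ → E × ℝ) (t : ℝ) : E :=
  (ω (sInf {n : ℕ | ENNReal.ofReal t < ∑ k ∈ Finset.range (n + 1), R.holdingTime ω k})).1

/-- There is no explosion: from every starting state, the jump times almost surely increase to
infinity. -/
def RateMatrix.NonExplosive [Countable E] [MeasurableSpace E] [DiscreteMeasurableSpace E] : Prop :=
  ∀ η : E, ∀ᵐ ω ∂(R.law η), ∑' n, R.holdingTime ω n = ∞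

/-- The hitting time `τ_A = inf {s > 0 : e_s ∈ A}` of a path, with `inf ∅ = ∞`. -/
def hittingTime (A : Set E) (e : ℝ → E) : ℝ≥0∞ :=
  ⨅ (s : ℝ) (_ : 0 < s) (_ : e s ∈ A), ENNReal.ofReal s

/-- The time `∫_0^{τ_A} 1{e_s ∈ F} ds` spent by a path in `F` before hitting `A`. -/
def timeSpent (A F : Set E) (e : ℝ → E) : ℝ≥0∞ :=
  ∫⁻ s in {s : ℝ | 0 < s ∧ ENNReal.ofReal s < hittingTime A e}, F.indicator (fun _ => 1) (e s)

/-- `E_η[T_A(F)]`. -/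
def RateMatrix.meanTimeSpent [Countable E] [MeasurableSpace E] [DiscreteMeasurableSpace E]
    (η : E) (A F : Set E) : ℝ≥0∞ :=
  ∫⁻ ω, timeSpent A F (R.path ω) ∂(R.law η)

end Path

section Sequences

variable {E : ℕ → Type*} [∀ N, Countable (E N)] [∀ N, MeasurableSpace (E N)]
  [∀ N, DiscreteMeasurableSpace (E N)]

/-- The laws, under `P_{η_N}`, of the `[0, ∞]`-valued random variables `X_N` converge weakly to
the mean-one exponential distribution. -/
def ConvergesToExp (R : ∀ N, RateMatrix (E N)) (η : ∀ N, E N)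
    (X : ∀ N, (ℕ → E N × ℝ) → ℝ≥0∞) : Prop :=
  TendstoInDistribution X atTop ENNReal.ofReal (fun N => (R N).law (η N)) (expMeasure 1)

/-- `(W, B, ξ)` is a valley of depth `θ` and attractor `ξ`. -/
structure IsValley (R : ∀ N, RateMatrix (E N)) (W B : ∀ N, Set (E N)) (ξ : ∀ N, E N)
    (θ : ℕ → ℝ) : Prop where
  depth_pos : ∀ N, 0 < θ N
  /-- (V1) -/
  attractor_first : ∀ η : ∀ N, E N, (∀ N, η N ∈ W N) →
    Tendsto (fun N => (R N).law (η N)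
      {ω | hittingTime {ξ N} ((R N).path ω) < hittingTime (B N)ᶜ ((R N).path ω)})
      atTop (𝓝 1)
  /-- (V2) -/
  exit_exponential : ∀ η : ∀ N, E N, (∀ N, η N ∈ W N) →
    ConvergesToExp R η
      (fun N ω => hittingTime (B N)ᶜ ((R N).path ω) / ENNReal.ofReal (θ N))
  /-- (V3) -/
  annulus_negligible : ∀ η : ∀ N, E N, (∀ N, η N ∈ W N) → ∀ δ : ℝ, 0 < δ →
    Tendsto (fun N => (R N).law (η N)
      {ω | ENNReal.ofReal δ
        < timeSpent (B N)ᶜ (B N \ W N) ((R N).path ω) / ENNReal.ofReal (θ N)})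
      atTop (𝓝 0)

/-- The conditions (i), (ii), (iii) at a point `η` of `W`. They presuppose that the expectations
that occur are finite for all large `N`; this is spelled out in the first two fields. -/
structure OccupationConditions (R : ∀ N, RateMatrix (E N)) (W B : ∀ N, Set (E N))
    (ξ η : ∀ N, E N) : Prop where
  exit_finite : ∀ᶠ N in atTop, (R N).meanTimeSpent (η N) (B N)ᶜ (W N) < ∞
  attractor_finite : ∀ᶠ N in atTop, (R N).meanTimeSpent (η N) {ξ N} (W N) < ∞
  /-- (i) -/
  attractor_negligible :
    Tendsto (fun N => (R N).meanTimeSpent (η N) {ξ N} (W N)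
      / (R N).meanTimeSpent (η N) (B N)ᶜ (W N)) atTop (𝓝 0)
  /-- (ii) -/
  exit_exponential :
    ConvergesToExp R η (fun N ω => timeSpent (B N)ᶜ (W N) ((R N).path ω)
      / (R N).meanTimeSpent (η N) (B N)ᶜ (W N))
  /-- (iii) -/
  annulus_negligible : ∀ δ : ℝ, 0 < δ →
    Tendsto (fun N => (R N).law (η N)
      {ω | ENNReal.ofReal δ < timeSpent (B N)ᶜ (B N \ W N) ((R N).path ω)
        / (R N).meanTimeSpent (η N) (B N)ᶜ (W N)})
      atTop (𝓝 0)

end Sequences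

end Valley

end

open Valley

/-! Write `T(F)` for the time spent in `F` before leaving `B`, `T_ξ(F)` for the time spent in `F`
before reaching `ξ`, and `Δ = B \ W`. All of these are sums of sojourn times of the jump chain, and
the exit time from `B` is `T(W) + T(Δ)`. Since the chain is sampled with its clocks, the only Markov
property needed is the one at the first jump. Statements at later hitting times follow by induction
on the number of sojourns counted, then by monotone limits.

Three facts about a single process carry the argument. A geometric tail (`law_mul_lt_occ_le`): if
the time spent in `F` exceeds `t` with probability at most `q` from each point of `F`, then from any
point it exceeds `k t` with probability at most `q ^ k`, because exponential clocks are memoryless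
and time in `F` accumulates only at points of `F`. Its mean is then at most `t / (1 - q)`
(`meanOcc_le_of_tail`). An upper comparison (`meanOcc_le_add`): `E_η[T(W)] ≤ E_η[T_ξ(W)] +
E_ξ[T(W)]`. A lower comparison (`meanOcc_add_reach_le`): the mean time in `W` before `Bᶜ ∪ {ξ}`,
plus `P_η[ξ before Bᶜ] * E_ξ[T(W)]`, is at most `E_η[T(W)]`.

(a) Removing the negligible `T(Δ)` shows that `T(W) / θ` is asymptotically exponential from every
sequence of points of `W`. Hence `T(W)` exceeds `θ` with probability at most `1/2`, uniformly on `W`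
for large `N`; the geometric tail dominates, and the means converge to one. In the lower comparison
the exit term already tends to one, so the mean time in `W` before `Bᶜ ∪ {ξ}` is `o(θ)`. As `ξ`
comes before `Bᶜ` with high probability, `T_ξ(W) / θ` tends to zero in probability, and the
geometric tail upgrades this to convergence of the means.

(b) Let `m = E_η[T(W)]`. If `B` is left no later than `ξ` is reached, then `T(W) ≤ T_ξ(W)`; so for
every `δ` either `T(W) ≤ δ m`, of limiting probability `1 - exp (-δ)`, or `T_ξ(W) > δ m`, negligible
by Markov's inequality. This gives (V1). The two comparisons now squeeze `E_ξ[T(W)] / m` to one, and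
changing the normalisation from `m` to `θ` preserves the limit laws. -/

noncomputable section

namespace Valley

/-! ### Laws of sequences determined by an initial law and a transition kernel -/

section Chain

variable {X : Type*}

/-- The sequence `ω` frozen from time `n` on. -/
def stopAt (n : ℕ) (ω : ℕ → X) : ℕ → X := fun i => ω (min i n)

/-- The sequence `x, ω 0, ω 1, …`. -/
def consSeq (x : X) (ω : ℕ → X) : ℕ → X := fun n => Nat.casesOn n x ω

@[simp] lemma consSeq_zero (x : X) (ω : ℕ → X) : consSeq x ω 0 = x := rfl

@[simp] lemma consSeq_succ (x : X) (ω : ℕ → X) (n : ℕ) : consSeq x ω (n + 1) = ω n := rfl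

lemma stopAt_zero_consSeq (x : X) (ω : ℕ → X) : stopAt 0 (consSeq x ω) = fun _ => x := by
  funext i
  simp [stopAt]

lemma stopAt_succ_consSeq (n : ℕ) (x : X) (ω : ℕ → X) :
    stopAt (n + 1) (consSeq x ω) = consSeq x (stopAt n ω) := by
  funext i
  cases i with
  | zero => simp [stopAt]
  | succ i => simp [stopAt, Nat.succ_min_succ]

variable [MeasurableSpace X]

@[fun_prop]
lemma measurable_stopAt (n : ℕ) : Measurable (stopAt n : (ℕ → X) → ℕ → X) :=
  measurable_pi_lambda _ fun _ => measurable_pi_apply _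

lemma measurable_consSeq : Measurable (fun p : X × (ℕ → X) => consSeq p.1 p.2) := by
  refine measurable_pi_lambda _ fun n => ?_
  cases n with
  | zero => exact measurable_fst
  | succ n => exact (measurable_pi_apply n).comp measurable_snd

lemma measurable_consSeq_right (x : X) : Measurable (consSeq x) :=
  measurable_consSeq.comp measurable_prodMk_left

/-- The law `μ` of a sequence has the one-step transition kernel `κ`. -/
def HasTransition (κ : Kernel X X) (μ : Measure (ℕ → X)) : Prop :=
  ∀ (n : ℕ) (H : (ℕ → X) × X → ℝ≥0∞), Measurable H →
    ∫⁻ ω, H (stopAt n ω, ω (n + 1)) ∂μ = ∫⁻ ω, ∫⁻ y, H (stopAt n ω, y) ∂(κ (ω n)) ∂μ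

/-- Induction on `n`: the sequence frozen at `n + 1` is glued from the sequence frozen at `n` and
the next state. Integrating the next state out against `κ` leaves a function of the former alone. -/
lemma HasTransition.lintegral_stopAt_eq {κ : Kernel X X} [IsMarkovKernel κ] {μ ν : Measure (ℕ → X)}
    (hμ : HasTransition κ μ) (hν : HasTransition κ ν)
    (h0 : ∀ f : X → ℝ≥0∞, Measurable f → ∫⁻ ω, f (ω 0) ∂μ = ∫⁻ ω, f (ω 0) ∂ν) (n : ℕ) :
    ∀ f : (ℕ → X) → ℝ≥0∞, Measurable f →
      ∫⁻ ω, f (stopAt n ω) ∂μ = ∫⁻ ω, f (stopAt n ω) ∂ν := by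
  induction n with
  | zero =>
    intro f hf
    have := h0 (fun x => f fun _ => x)
      (hf.comp (measurable_pi_lambda _ fun _ => measurable_id))
    have hst : ∀ ω : ℕ → X, stopAt 0 ω = fun _ => ω 0 := fun ω => by
      funext i
      simp [stopAt]
    simpa only [hst] using this
  | succ n ih =>
    intro f hf
    let glue : (ℕ → X) × X → (ℕ → X) := fun p i => if i ≤ n then p.1 i else p.2
    have hglue : Measurable glue := by
      refine measurable_pi_lambda _ fun i => ?_
      by_cases h : i ≤ n
      · simpa [glue, h, Function.comp_def] using
          (measurable_pi_apply (X := fun _ : ℕ => X) i).comp (measurable_fst (β := X))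
      · simpa [glue, h] using measurable_snd
    have hst : ∀ ω : ℕ → X, stopAt (n + 1) ω = glue (stopAt n ω, ω (n + 1)) := by
      intro ω
      funext i
      by_cases h : i ≤ n
      · simp [glue, stopAt, h, h.trans n.le_succ]
      · have : n + 1 ≤ i := by omega
        simp [glue, stopAt, h, this]
    have hm : Measurable fun p => f (glue p) := hf.comp hglue
    simp_rw [hst]
    rw [hμ n _ hm, hν n _ hm]
    have hK : Measurable fun ω : ℕ → X => ∫⁻ y, f (glue (ω, y)) ∂(κ (ω n)) :=
      Measurable.lintegral_kernel_prod_right' (κ := κ.comap (fun ω : ℕ → X => ω n)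
        (measurable_pi_apply n)) hm
    have := ih _ hK
    simpa [stopAt] using this

/-- A cylinder depends on finitely many coordinates, hence is unaffected by freezing the sequence at
the largest of them; cylinders form a generating π-system. -/
lemma HasTransition.ext {κ : Kernel X X} [IsMarkovKernel κ] {μ ν : Measure (ℕ → X)}
    [IsProbabilityMeasure μ] [IsProbabilityMeasure ν]
    (hμ : HasTransition κ μ) (hν : HasTransition κ ν)
    (h0 : ∀ f : X → ℝ≥0∞, Measurable f → ∫⁻ ω, f (ω 0) ∂μ = ∫⁻ ω, f (ω 0) ∂ν) : μ = ν := by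
  refine ext_of_generate_finite _ generateFrom_measurableCylinders.symm
    isPiSystem_measurableCylinders ?_ (by simp)
  intro S hS
  obtain ⟨s, T, hT, rfl⟩ := (mem_measurableCylinders S).1 hS
  have hm : MeasurableSet (cylinder s T) := MeasurableSet.cylinder (α := fun _ : ℕ => X) s hT
  have key : ∀ ω : ℕ → X, (cylinder s T).indicator (fun _ => (1 : ℝ≥0∞)) (stopAt (s.sup id) ω)
      = (cylinder s T).indicator (fun _ => (1 : ℝ≥0∞)) ω := by
    intro ω
    have : s.restrict (stopAt (s.sup id) ω) = s.restrict ω := by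
      funext i
      have : (i : ℕ) ≤ s.sup id := Finset.le_sup (f := id) i.2
      simp [stopAt, this]
    have h' : stopAt (s.sup id) ω ∈ cylinder s T ↔ ω ∈ cylinder s T := by
      change s.restrict (stopAt (s.sup id) ω) ∈ T ↔ s.restrict ω ∈ T
      rw [this]
    by_cases hω : ω ∈ cylinder s T
    · exact (Set.indicator_of_mem (h'.2 hω) _).trans (Set.indicator_of_mem hω fun _ => 1).symm
    · exact (Set.indicator_of_notMem (fun h => hω (h'.1 h)) _).trans
        (Set.indicator_of_notMem hω _).symm
  have h := hμ.lintegral_stopAt_eq hν h0 (s.sup id)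
    ((cylinder s T).indicator fun _ => (1 : ℝ≥0∞)) (measurable_const.indicator hm)
  simp_rw [key] at h
  simpa [lintegral_indicator hm] using h

end Chain

/-! ### The Markov property at the first jump -/

namespace RateMatrix

variable {E : Type*} (R : RateMatrix E)
variable [Countable E] [MeasurableSpace E] [DiscreteMeasurableSpace E]

lemma hasTransition_law (η : E) : HasTransition R.stepKernel (R.law η) := by
  intro n H hH
  let ext : (Π _ : Finset.Iic n, E × ℝ) → (ℕ → E × ℝ) :=
    fun p i => p ⟨min i n, Finset.mem_Iic.2 (min_le_right _ _)⟩
  have hext : Measurable ext := measurable_pi_lambda _ fun _ => measurable_pi_apply _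
  have hst : ∀ ω : ℕ → E × ℝ, stopAt n ω = ext (Preorder.frestrictLe n ω) := fun _ => rfl
  have h := Kernel.map_frestrictLe_trajMeasure_compProd_eq_map_trajMeasure
    (X := fun _ => E × ℝ) (μ₀ := (Measure.dirac η).prod (expMeasure 1)) (κ := R.pastKernel) (a := n)
  change (R.law η).map (Preorder.frestrictLe n) ⊗ₘ R.pastKernel n =
    (R.law η).map (fun x => (Preorder.frestrictLe n x, x (n + 1))) at h
  have hm : Measurable fun p : (Π _ : Finset.Iic n, E × ℝ) × (E × ℝ) => H (ext p.1, p.2) := by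
    fun_prop
  have h2 := congrArg (fun μ => ∫⁻ p, H (ext p.1, p.2) ∂μ) h
  rw [Measure.lintegral_compProd hm, lintegral_map hm (by fun_prop),
    lintegral_map ?_ (by fun_prop)] at h2
  · exact h2.symm
  · exact Measurable.lintegral_kernel_prod_right' hm

lemma lintegral_law_zero (η : E) {f : E × ℝ → ℝ≥0∞} (hf : Measurable f) :
    ∫⁻ ω, f (ω 0) ∂(R.law η) = ∫⁻ u, f (η, u) ∂(expMeasure 1) := by
  let g : (Π _ : Finset.Iic 0, E × ℝ) → ℝ≥0∞ := fun p => f (p ⟨0, Finset.mem_Iic.2 le_rfl⟩)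
  have hg : Measurable g := hf.comp (measurable_pi_apply _)
  have : ∫⁻ ω, f (ω 0) ∂(R.law η) = ∫⁻ p, g p ∂((R.law η).map (Preorder.frestrictLe 0)) := by
    rw [lintegral_map hg (by fun_prop)]
    rfl
  rw [this, law, Kernel.trajMeasure, Measure.map_comp _ _ (by fun_prop),
    Kernel.traj_map_frestrictLe, Kernel.partialTraj_self, Measure.id_comp,
    lintegral_map hg (by fun_prop)]
  have : ∀ a : E × ℝ, g ((MeasurableEquiv.piUnique fun _ : Finset.Iic 0 => E × ℝ).symm a) = f a :=
    fun a => rfl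
  erw [lintegral_congr this]
  rw [lintegral_prod _ hf.aemeasurable, lintegral_dirac]

/-- The laws `P_η` as a kernel. -/
def lawKernel : Kernel E (ℕ → E × ℝ) := Kernel.ofFunOfCountable R.law

lemma lawKernel_apply (η : E) : R.lawKernel η = R.law η := rfl

instance : IsMarkovKernel R.lawKernel :=
  ⟨fun η => by
    rw [lawKernel_apply]
    infer_instance⟩

lemma lintegral_stepKernel (x : E × ℝ) {f : E × ℝ → ℝ≥0∞} (hf : Measurable f) :
    ∫⁻ y, f y ∂(R.stepKernel x)
      = ∫⁻ ζ, ∫⁻ u, f (ζ, u) ∂(expMeasure 1) ∂(R.jumpKernel x.1) := by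
  rw [stepKernel, Kernel.prod_apply, lintegral_prod _ hf.aemeasurable]
  simp [Kernel.comap_apply]

/-- The law of a first state `η` with its clock, followed by the chain started from a state drawn
from the jump distribution at `η`. -/
def firstStepLaw (η : E) : Measure (ℕ → E × ℝ) :=
  (((Measure.dirac η).prod (expMeasure 1)).prod (R.lawKernel ∘ₘ R.jumpKernel η)).map
    fun p => consSeq p.1 p.2

instance (η : E) : IsProbabilityMeasure (R.firstStepLaw η) :=
  Measure.isProbabilityMeasure_map measurable_consSeq.aemeasurable

lemma lintegral_firstStepLaw (η : E) {f : (ℕ → E × ℝ) → ℝ≥0∞} (hf : Measurable f) :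
    ∫⁻ ω, f ω ∂(R.firstStepLaw η)
      = ∫⁻ u, ∫⁻ ζ, ∫⁻ ω, f (consSeq (η, u) ω) ∂(R.law ζ) ∂(R.jumpKernel η) ∂(expMeasure 1) := by
  have h1 : Measurable fun p : (E × ℝ) × (ℕ → E × ℝ) => f (consSeq p.1 p.2) :=
    hf.comp measurable_consSeq
  rw [firstStepLaw, lintegral_map hf measurable_consSeq, lintegral_prod _ h1.aemeasurable,
    lintegral_prod _ h1.lintegral_prod_right'.aemeasurable, lintegral_dirac]
  refine lintegral_congr fun u => ?_
  rw [Measure.lintegral_bind R.lawKernel.measurable.aemeasurable]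
  · rfl
  · exact (h1.comp measurable_prodMk_left).aemeasurable

lemma hasTransition_firstStepLaw (η : E) : HasTransition R.stepKernel (R.firstStepLaw η) := by
  intro n H hH
  have hK : Measurable fun ω : ℕ → E × ℝ => ∫⁻ y, H (stopAt n ω, y) ∂(R.stepKernel (ω n)) :=
    Measurable.lintegral_kernel_prod_right' (κ := R.stepKernel.comap (fun ω : ℕ → E × ℝ => ω n)
      (measurable_pi_apply n)) (f := fun p => H (stopAt n p.1, p.2)) (by fun_prop)
  rw [lintegral_firstStepLaw R η (f := fun ω => H (stopAt n ω, ω (n + 1))) (by fun_prop),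
    lintegral_firstStepLaw R η hK]
  refine lintegral_congr fun u => ?_
  cases n with
  | zero =>
    simp only [stopAt_zero_consSeq, consSeq_succ, consSeq_zero, lintegral_const, measure_univ,
      mul_one]
    have hm : Measurable fun y => H (fun _ => (η, u), y) := hH.comp measurable_prodMk_left
    rw [lintegral_stepKernel R _ hm]
    exact lintegral_congr fun ζ => R.lintegral_law_zero ζ hm
  | succ n =>
    refine lintegral_congr fun ζ => ?_
    simp only [stopAt_succ_consSeq, consSeq_succ]
    refine R.hasTransition_law ζ n (fun p => H (consSeq (η, u) p.1, p.2)) ?_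
    refine hH.comp (Measurable.prodMk ?_ measurable_snd)
    exact measurable_consSeq.comp (measurable_const.prodMk measurable_fst)

/-- Both laws have the transition kernel `stepKernel` and the same initial law, so uniqueness
applies. -/
lemma law_eq_firstStepLaw (η : E) : R.law η = R.firstStepLaw η := by
  refine (R.hasTransition_law η).ext (R.hasTransition_firstStepLaw η) fun f hf => ?_
  rw [R.lintegral_law_zero η hf, R.lintegral_firstStepLaw η (f := fun ω => f (ω 0)) (by fun_prop)]
  simp

/-- The Markov property at the first jump. -/
lemma lintegral_law (η : E) {f : (ℕ → E × ℝ) → ℝ≥0∞} (hf : Measurable f) :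
    ∫⁻ ω, f ω ∂(R.law η)
      = ∫⁻ u, ∫⁻ ζ, ∫⁻ ω, f (consSeq (η, u) ω) ∂(R.law ζ) ∂(R.jumpKernel η) ∂(expMeasure 1) := by
  rw [law_eq_firstStepLaw, R.lintegral_firstStepLaw η hf]

end RateMatrix

/-! ### The mean-one exponential distribution -/

lemma expMeasure_one_Iic_zero : expMeasure 1 (Set.Iic 0) = 0 := by
  have h := cdf_expMeasure_eq one_pos 0
  rw [cdf_eq_real] at h
  simpa [measureReal_eq_zero_iff] using h

lemma ae_expMeasure_one_pos : ∀ᵐ u ∂(expMeasure 1), 0 < u := by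
  rw [ae_iff]
  have : {u : ℝ | ¬ 0 < u} = Set.Iic 0 := by
    ext u
    simp
  rw [this, expMeasure_one_Iic_zero]

lemma expMeasure_one_Ioi {t : ℝ} (ht : 0 ≤ t) :
    expMeasure 1 (Set.Ioi t) = ENNReal.ofReal (Real.exp (-t)) := by
  have h := cdf_expMeasure_eq one_pos t
  rw [cdf_eq_real, if_pos ht] at h
  have h1 := probReal_compl_eq_one_sub (μ := expMeasure 1) (measurableSet_Iic (a := t))
  rw [h, Set.compl_Iic, one_mul, sub_sub_cancel] at h1
  rw [← h1, ofReal_measureReal]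

/-- The memoryless property of the exponential distribution. -/
lemma setLIntegral_Ioi_expMeasure_one {s : ℝ} (hs : 0 ≤ s) {g : ℝ → ℝ≥0∞} (hg : Measurable g) :
    ∫⁻ u in Set.Ioi s, g u ∂(expMeasure 1)
      = expMeasure 1 (Set.Ioi s) * ∫⁻ u, g (u + s) ∂(expMeasure 1) := by
  have hpdf : Measurable (exponentialPDF 1) :=
    (measurable_exponentialPDFReal 1).ennreal_ofReal
  have hexp : expMeasure 1 = volume.withDensity (exponentialPDF 1) := rfl
  have hind : Measurable ((Set.Ioi s).indicator g) := hg.indicator measurableSet_Ioi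
  rw [expMeasure_one_Ioi hs, ← lintegral_indicator measurableSet_Ioi, hexp,
    lintegral_withDensity_eq_lintegral_mul _ hpdf hind,
    lintegral_withDensity_eq_lintegral_mul _ hpdf (by fun_prop),
    ← lintegral_const_mul _ (by fun_prop), ← lintegral_add_right_eq_self _ s]
  refine lintegral_congr_ae ?_
  -- At `u = 0` the two integrands may differ: the density is `1` there, while the open half-line
  -- excludes `s`.
  have h0 : ∀ᵐ u : ℝ ∂volume, u ≠ 0 := by simp [ae_iff]
  filter_upwards [h0] with u hu
  simp only [Pi.mul_apply]
  rcases lt_or_gt_of_ne hu with h | h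
  · rw [exponentialPDF_of_neg h, Set.indicator_of_notMem (by simpa using h.le)]
    simp
  · rw [exponentialPDF_of_nonneg h.le, exponentialPDF_of_nonneg (by positivity),
      Set.indicator_of_mem (by simpa using h), ← mul_assoc, ← ENNReal.ofReal_mul (by positivity)]
    congr 2
    rw [one_mul, one_mul, one_mul, one_mul, ← Real.exp_add]
    ring_nf

/-! ### Occupation times as sums over sojourns, and their means -/

namespace RateMatrix

variable {E : Type*} (R : RateMatrix E)

/-- The time that the clock value `x.2` lets the process spend in the state `x.1`. -/
def clock (x : E × ℝ) : ℝ≥0∞ := ENNReal.ofReal x.2 / ENNReal.ofReal (R.holdingRate x.1)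

/-- The time spent in `F` during the `k`-th sojourn, if `A` has not been visited by then. -/
def occTerm (A F : Set E) (k : ℕ) (ω : ℕ → E × ℝ) : ℝ≥0∞ :=
  {ω : ℕ → E × ℝ | (∀ j ≤ k, (ω j).1 ∉ A) ∧ (ω k).1 ∈ F}.indicator (fun ω => R.clock (ω k)) ω

lemma occTerm_of_pos {A F : Set E} {k : ℕ} {ω : ℕ → E × ℝ}
    (h : (∀ j ≤ k, (ω j).1 ∉ A) ∧ (ω k).1 ∈ F) : R.occTerm A F k ω = R.clock (ω k) :=
  Set.indicator_of_mem (s := {ω : ℕ → E × ℝ | (∀ j ≤ k, (ω j).1 ∉ A) ∧ (ω k).1 ∈ F}) h _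

lemma occTerm_of_neg {A F : Set E} {k : ℕ} {ω : ℕ → E × ℝ}
    (h : ¬ ((∀ j ≤ k, (ω j).1 ∉ A) ∧ (ω k).1 ∈ F)) : R.occTerm A F k ω = 0 :=
  Set.indicator_of_notMem (s := {ω : ℕ → E × ℝ | (∀ j ≤ k, (ω j).1 ∉ A) ∧ (ω k).1 ∈ F}) h _

/-- The time spent in `F` before the first visit to `A` and during the first `n` sojourns. -/
def occUpTo (A F : Set E) (n : ℕ) (ω : ℕ → E × ℝ) : ℝ≥0∞ :=
  ∑ k ∈ Finset.range n, R.occTerm A F k ω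

/-- The time spent in `F` before the first visit to `A`, read off from the sojourns. -/
def occ (A F : Set E) (ω : ℕ → E × ℝ) : ℝ≥0∞ := ∑' k, R.occTerm A F k ω

/-- The chain visits `ξ` among its first `n` states, and not after visiting `A`. -/
def ReachUpTo (ξ : E) (A : Set E) (n : ℕ) (ω : ℕ → E × ℝ) : Prop :=
  ∃ k < n, (ω k).1 = ξ ∧ ∀ j ≤ k, (ω j).1 ∉ A

/-- The chain visits `ξ`, and not after visiting `A`. -/
def Reach (ξ : E) (A : Set E) (ω : ℕ → E × ℝ) : Prop := ∃ k, (ω k).1 = ξ ∧ ∀ j ≤ k, (ω j).1 ∉ A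

lemma setOf_reach_eq_iUnion (ξ : E) (A : Set E) :
    {ω : ℕ → E × ℝ | Reach ξ A ω} = ⋃ n, {ω : ℕ → E × ℝ | ReachUpTo ξ A n ω} := by
  ext ω
  simp only [Reach, ReachUpTo, Set.mem_ofPred_eq, Set.mem_iUnion]
  exact ⟨fun ⟨k, h⟩ => ⟨k + 1, k, k.lt_succ_self, h⟩, fun ⟨_, k, _, h⟩ => ⟨k, h⟩⟩

lemma occ_eq_iSup (A F : Set E) (ω : ℕ → E × ℝ) : R.occ A F ω = ⨆ n, R.occUpTo A F n ω :=
  ENNReal.tsum_eq_iSup_nat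

lemma monotone_occUpTo (A F : Set E) : Monotone (R.occUpTo A F) := fun _ _ h _ =>
  Finset.sum_le_sum_of_subset (Finset.range_mono h)

lemma occUpTo_le_occ (A F : Set E) (n : ℕ) (ω : ℕ → E × ℝ) :
    R.occUpTo A F n ω ≤ R.occ A F ω := ENNReal.sum_le_tsum _

lemma forall_le_succ_consSeq (A : Set E) (k : ℕ) (x : E × ℝ) (ω : ℕ → E × ℝ) :
    (∀ j ≤ k + 1, (consSeq x ω j).1 ∉ A) ↔ x.1 ∉ A ∧ ∀ j ≤ k, (ω j).1 ∉ A := by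
  constructor
  · intro h
    exact ⟨h 0 (Nat.zero_le _), fun j hj => h (j + 1) (by omega)⟩
  · rintro ⟨h0, h⟩ j hj
    cases j with
    | zero => exact h0
    | succ j => exact h j (by omega)

lemma occTerm_zero_consSeq (A F : Set E) {x : E × ℝ} (hA : x.1 ∉ A) (ω : ℕ → E × ℝ) :
    R.occTerm A F 0 (consSeq x ω) = F.indicator (fun _ => R.clock x) x.1 := by
  by_cases hF : x.1 ∈ F
  · rw [R.occTerm_of_pos, Set.indicator_of_mem hF, consSeq_zero]
    exact ⟨fun j hj => by rw [Nat.le_zero.1 hj]; exact hA, hF⟩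
  · rw [R.occTerm_of_neg (fun h => hF h.2), Set.indicator_of_notMem hF]

lemma occTerm_succ_consSeq (A F : Set E) {x : E × ℝ} (hA : x.1 ∉ A) (k : ℕ) (ω : ℕ → E × ℝ) :
    R.occTerm A F (k + 1) (consSeq x ω) = R.occTerm A F k ω := by
  by_cases h : (∀ j ≤ k, (ω j).1 ∉ A) ∧ (ω k).1 ∈ F
  · rw [R.occTerm_of_pos h, R.occTerm_of_pos, consSeq_succ]
    exact ⟨(forall_le_succ_consSeq A k x ω).2 ⟨hA, h.1⟩, h.2⟩
  · rw [R.occTerm_of_neg h, R.occTerm_of_neg]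
    exact fun h' => h ⟨((forall_le_succ_consSeq A k x ω).1 h'.1).2, h'.2⟩

lemma occTerm_of_mem {A F : Set E} {ω : ℕ → E × ℝ} (hA : (ω 0).1 ∈ A) (k : ℕ) :
    R.occTerm A F k ω = 0 :=
  R.occTerm_of_neg fun h => h.1 0 (Nat.zero_le _) hA

lemma occUpTo_succ_consSeq (A F : Set E) {x : E × ℝ} (hA : x.1 ∉ A) (n : ℕ) (ω : ℕ → E × ℝ) :
    R.occUpTo A F (n + 1) (consSeq x ω)
      = F.indicator (fun _ => R.clock x) x.1 + R.occUpTo A F n ω := by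
  rw [occUpTo, Finset.sum_range_succ', occTerm_zero_consSeq R A F hA, add_comm]
  simp only [occTerm_succ_consSeq R A F hA, occUpTo]

lemma occ_consSeq (A F : Set E) {x : E × ℝ} (hA : x.1 ∉ A) (ω : ℕ → E × ℝ) :
    R.occ A F (consSeq x ω) = F.indicator (fun _ => R.clock x) x.1 + R.occ A F ω := by
  rw [occ, tsum_eq_zero_add' ENNReal.summable, occTerm_zero_consSeq R A F hA]
  simp only [occTerm_succ_consSeq R A F hA, occ]

lemma occUpTo_of_mem {A F : Set E} {ω : ℕ → E × ℝ} (hA : (ω 0).1 ∈ A) (n : ℕ) :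
    R.occUpTo A F n ω = 0 := by
  simp [occUpTo, R.occTerm_of_mem hA]

lemma occ_of_mem {A F : Set E} {ω : ℕ → E × ℝ} (hA : (ω 0).1 ∈ A) : R.occ A F ω = 0 := by
  simp [occ, R.occTerm_of_mem hA]

lemma reachUpTo_succ_consSeq (ξ : E) (A : Set E) {x : E × ℝ} (hA : x.1 ∉ A) (hξ : x.1 ≠ ξ)
    (n : ℕ) (ω : ℕ → E × ℝ) :
    ReachUpTo ξ A (n + 1) (consSeq x ω) ↔ ReachUpTo ξ A n ω := by
  constructor
  · rintro ⟨k, hk, h1, h2⟩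
    cases k with
    | zero => exact absurd h1 hξ
    | succ k => exact ⟨k, by omega, h1, ((forall_le_succ_consSeq A k x ω).1 h2).2⟩
  · rintro ⟨k, hk, h1, h2⟩
    exact ⟨k + 1, by omega, h1, (forall_le_succ_consSeq A k x ω).2 ⟨hA, h2⟩⟩

/-- If `ξ` is not visited before `A`, every sojourn that precedes `A` also precedes `ξ`, so the
comparison holds term by term. -/
lemma occ_le_of_not_reach {ξ : E} {A F : Set E} {ω : ℕ → E × ℝ} (h : ¬ Reach ξ A ω) :
    R.occ A F ω ≤ R.occ {ξ} F ω := by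
  refine ENNReal.tsum_le_tsum fun k => ?_
  by_cases hk : (∀ j ≤ k, (ω j).1 ∉ A) ∧ (ω k).1 ∈ F
  · rw [R.occTerm_of_pos hk, R.occTerm_of_pos]
    refine ⟨fun j hj hξ => h ⟨j, hξ, fun i hi => hk.1 i (hi.trans hj)⟩, hk.2⟩
  · rw [R.occTerm_of_neg hk]
    exact zero_le

/-- When `ξ` comes before `A`, the sojourns that precede `ξ` precede `A` as well. -/
lemma occ_le_of_reach {ξ : E} {A F : Set E} {ω : ℕ → E × ℝ} (h : Reach ξ A ω) :
    R.occ {ξ} F ω ≤ R.occ (A ∪ {ξ}) F ω := by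
  obtain ⟨n, hn, hA⟩ := h
  refine ENNReal.tsum_le_tsum fun k => ?_
  by_cases hk : (∀ j ≤ k, (ω j).1 ∉ ({ξ} : Set E)) ∧ (ω k).1 ∈ F
  · rw [R.occTerm_of_pos hk, R.occTerm_of_pos]
    refine ⟨fun j hj hmem => ?_, hk.2⟩
    rcases hmem with hmem | hmem
    · rcases le_or_gt j n with h' | h'
      · exact hA j h' hmem
      · exact hk.1 n (by omega) hn
    · exact hk.1 j hj hmem
  · rw [R.occTerm_of_neg hk]
    exact zero_le

variable [MeasurableSpace E] [DiscreteMeasurableSpace E]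

lemma measurableSet_state (A : Set E) (k : ℕ) :
    MeasurableSet {ω : ℕ → E × ℝ | (ω k).1 ∈ A} :=
  (measurable_fst.comp (measurable_pi_apply k)) (MeasurableSet.of_discrete (s := A))

lemma measurableSet_forall_notMem (A : Set E) (k : ℕ) :
    MeasurableSet {ω : ℕ → E × ℝ | ∀ j ≤ k, (ω j).1 ∉ A} := by
  have : {ω : ℕ → E × ℝ | ∀ j ≤ k, (ω j).1 ∉ A}
      = ⋂ j, ⋂ (_ : j ≤ k), {ω : ℕ → E × ℝ | (ω j).1 ∈ A}ᶜ := by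
    ext ω
    simp
  rw [this]
  exact MeasurableSet.iInter fun j => MeasurableSet.iInter fun _ => (measurableSet_state A j).compl

lemma measurableSet_reachUpTo (ξ : E) (A : Set E) (n : ℕ) :
    MeasurableSet {ω : ℕ → E × ℝ | ReachUpTo ξ A n ω} := by
  have : {ω : ℕ → E × ℝ | ReachUpTo ξ A n ω}
      = ⋃ k, ⋃ (_ : k < n), {ω : ℕ → E × ℝ | (ω k).1 ∈ ({ξ} : Set E)}
        ∩ {ω : ℕ → E × ℝ | ∀ j ≤ k, (ω j).1 ∉ A} := by
    ext ω
    simp only [ReachUpTo, Set.mem_ofPred_eq, Set.mem_iUnion, Set.mem_inter_iff,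
      Set.mem_singleton_iff, exists_prop]
  rw [this]
  exact MeasurableSet.iUnion fun k => MeasurableSet.iUnion fun _ =>
    (measurableSet_state _ k).inter (measurableSet_forall_notMem A k)

lemma measurableSet_reach (ξ : E) (A : Set E) :
    MeasurableSet {ω : ℕ → E × ℝ | Reach ξ A ω} := by
  rw [setOf_reach_eq_iUnion]
  exact MeasurableSet.iUnion fun n => measurableSet_reachUpTo ξ A n

variable [Countable E]

@[fun_prop]
lemma measurable_clock : Measurable R.clock :=
  measurable_from_prod_countable_right fun η => by
    change Measurable fun u : ℝ => ENNReal.ofReal u / ENNReal.ofReal (R.holdingRate η)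
    fun_prop

@[fun_prop]
lemma measurable_occTerm (A F : Set E) (k : ℕ) : Measurable (R.occTerm A F k) :=
  (R.measurable_clock.comp (measurable_pi_apply k)).indicator
    ((measurableSet_forall_notMem A k).inter (measurableSet_state F k))

@[fun_prop]
lemma measurable_occUpTo (A F : Set E) (n : ℕ) : Measurable (R.occUpTo A F n) :=
  Finset.measurable_fun_sum _ fun k _ => R.measurable_occTerm A F k

@[fun_prop]
lemma measurable_occ (A F : Set E) : Measurable (R.occ A F) :=
  Measurable.tsum fun k => R.measurable_occTerm A F k

/-- The Markov property at the first jump, for events. -/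
lemma law_apply (η : E) {S : Set (ℕ → E × ℝ)} (hS : MeasurableSet S) :
    R.law η S = ∫⁻ u, ∫⁻ ζ, R.law ζ {ω | consSeq (η, u) ω ∈ S} ∂(R.jumpKernel η)
      ∂(expMeasure 1) := by
  rw [← lintegral_indicator_one hS, R.lintegral_law η (measurable_one.indicator hS)]
  refine lintegral_congr fun u => lintegral_congr fun ζ => ?_
  exact lintegral_indicator_one (measurable_consSeq_right (η, u) hS)

/-- The initial state is `η` almost surely under `P_η`. -/
lemma ae_law_zero (η : E) : ∀ᵐ ω ∂(R.law η), (ω 0).1 = η := by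
  rw [ae_iff]
  have hm : MeasurableSet {ω : ℕ → E × ℝ | ¬ (ω 0).1 = η} := (measurableSet_state {η} 0).compl
  rw [R.law_apply η hm]
  simp

/-- The mean of the first holding time at `η`. -/
def meanClock (η : E) : ℝ≥0∞ := ∫⁻ u, R.clock (η, u) ∂(expMeasure 1)

/-- `E_η` of the time spent in `F` before the first visit to `A`, during `n` sojourns. -/
def meanOccUpTo (A F : Set E) (n : ℕ) (η : E) : ℝ≥0∞ := ∫⁻ ω, R.occUpTo A F n ω ∂(R.law η)

/-- `E_η` of the time spent in `F` before the first visit to `A`. -/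
def meanOcc (A F : Set E) (η : E) : ℝ≥0∞ := ∫⁻ ω, R.occ A F ω ∂(R.law η)

lemma meanOcc_eq_iSup (A F : Set E) (η : E) :
    R.meanOcc A F η = ⨆ n, R.meanOccUpTo A F n η := by
  unfold meanOcc meanOccUpTo
  simp_rw [occ_eq_iSup]
  exact lintegral_iSup (fun n => R.measurable_occUpTo A F n) (R.monotone_occUpTo A F)

lemma meanOcc_of_mem {A F : Set E} {η : E} (h : η ∈ A) : R.meanOcc A F η = 0 := by
  unfold meanOcc
  rw [lintegral_eq_zero_iff (R.measurable_occ A F)]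
  filter_upwards [R.ae_law_zero η] with ω hω
  exact R.occ_of_mem (by rwa [hω])

lemma meanOccUpTo_of_mem {A F : Set E} {η : E} (h : η ∈ A) (n : ℕ) :
    R.meanOccUpTo A F n η = 0 := by
  have := R.meanOcc_of_mem (F := F) h
  rw [meanOcc_eq_iSup] at this
  simpa using (ENNReal.iSup_eq_zero.1 this) n

/-- The shared computation behind the first-step equations for full and truncated occupation times:
the first clock and the rest of the chain contribute separately. -/
lemma lintegral_meanClock_add (F : Set E) (η : E) {f : (ℕ → E × ℝ) → ℝ≥0∞} (hf : Measurable f) :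
    ∫⁻ u, ∫⁻ ζ, ∫⁻ ω, (F.indicator (fun _ => R.clock (η, u)) η + f ω) ∂(R.law ζ)
      ∂(R.jumpKernel η) ∂(expMeasure 1)
      = F.indicator R.meanClock η + ∫⁻ ζ, ∫⁻ ω, f ω ∂(R.law ζ) ∂(R.jumpKernel η) := by
  have h1 : ∀ u ζ, ∫⁻ ω, (F.indicator (fun _ => R.clock (η, u)) η + f ω) ∂(R.law ζ)
      = F.indicator (fun _ => R.clock (η, u)) η + ∫⁻ ω, f ω ∂(R.law ζ) := fun u ζ => by
    rw [lintegral_add_right _ hf]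
    simp
  have h2 : Measurable fun ζ => ∫⁻ ω, f ω ∂(R.law ζ) := Measurable.of_discrete
  simp_rw [h1, lintegral_add_right _ h2]
  rw [lintegral_add_right _ measurable_const]
  simp only [lintegral_const, measure_univ, mul_one]
  by_cases h : η ∈ F <;> simp [h, meanClock]

lemma meanOcc_of_notMem {A : Set E} (F : Set E) {η : E} (h : η ∉ A) :
    R.meanOcc A F η
      = F.indicator R.meanClock η + ∫⁻ ζ, R.meanOcc A F ζ ∂(R.jumpKernel η) := by
  unfold meanOcc
  rw [R.lintegral_law η (R.measurable_occ A F), ← R.lintegral_meanClock_add F η (by fun_prop)]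
  simp_rw [fun u => R.occ_consSeq A F (x := (η, u)) h]

lemma meanOccUpTo_succ_of_notMem {A : Set E} (F : Set E) {η : E} (h : η ∉ A) (n : ℕ) :
    R.meanOccUpTo A F (n + 1) η
      = F.indicator R.meanClock η + ∫⁻ ζ, R.meanOccUpTo A F n ζ ∂(R.jumpKernel η) := by
  unfold meanOccUpTo
  rw [R.lintegral_law η (by fun_prop), ← R.lintegral_meanClock_add F η (by fun_prop)]
  simp_rw [fun u => R.occUpTo_succ_consSeq A F (x := (η, u)) h]

/-- The mean time spent before `A` is at most the mean time spent before `ξ` plus the mean time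
spent before `A` by the process started from `ξ`. -/
lemma meanOcc_le_add (A F : Set E) (ξ η : E) :
    R.meanOcc A F η ≤ R.meanOcc {ξ} F η + R.meanOcc A F ξ := by
  -- Truncating only the left side makes an induction on the first step possible. Off `A` and `ξ`
  -- both sides satisfy the same first-step equation; at `ξ` the second summand alone suffices.
  have key : ∀ n η, R.meanOccUpTo A F n η ≤ R.meanOcc {ξ} F η + R.meanOcc A F ξ := by
    intro n
    induction n with
    | zero => intro η; simp [meanOccUpTo, occUpTo]
    | succ n ih =>
      intro η
      by_cases hA : η ∈ A
      · rw [R.meanOccUpTo_of_mem hA]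
        exact zero_le
      by_cases hξ : η = ξ
      · subst hξ
        refine le_trans ?_ le_add_self
        rw [R.meanOcc_eq_iSup]
        exact le_iSup (fun n => R.meanOccUpTo A F n η) (n + 1)
      rw [R.meanOccUpTo_succ_of_notMem F hA, R.meanOcc_of_notMem (A := {ξ}) F hξ, add_assoc]
      gcongr
      calc ∫⁻ ζ, R.meanOccUpTo A F n ζ ∂(R.jumpKernel η)
          ≤ ∫⁻ ζ, (R.meanOcc {ξ} F ζ + R.meanOcc A F ξ) ∂(R.jumpKernel η) := lintegral_mono ih
        _ = _ := by
          rw [lintegral_add_right _ measurable_const]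
          simp
  rw [R.meanOcc_eq_iSup A F η]
  exact iSup_le fun n => key n η

/-- Restarting at the first visit to `ξ`, on the event that it precedes the first visit to `A`. -/
lemma meanOcc_add_reach_le (A F : Set E) (ξ η : E) :
    R.meanOcc (A ∪ {ξ}) F η + R.law η {ω | Reach ξ A ω} * R.meanOcc A F ξ
      ≤ R.meanOcc A F η := by
  -- The left side is truncated in both terms at the same `n`, so that they advance together at the
  -- first step; at `ξ` the occupation term vanishes and the probability is bounded by one.
  have key : ∀ n η, R.meanOccUpTo (A ∪ {ξ}) F n η
      + R.law η {ω | ReachUpTo ξ A n ω} * R.meanOcc A F ξ ≤ R.meanOcc A F η := by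
    intro n
    induction n with
    | zero => intro η; simp [meanOccUpTo, occUpTo, ReachUpTo]
    | succ n ih =>
      intro η
      by_cases hA : η ∈ A
      · have h0 : R.law η {ω | ReachUpTo ξ A (n + 1) ω} = 0 := by
          have h := R.ae_law_zero η
          rw [← compl_mem_ae_iff]
          filter_upwards [h] with ω hω
          rintro ⟨k, _, _, hk⟩
          exact hk 0 (Nat.zero_le _) (by rwa [hω])
        rw [R.meanOccUpTo_of_mem (Or.inl hA), h0]
        simp
      by_cases hξ : η = ξ
      · subst hξ
        rw [R.meanOccUpTo_of_mem (Or.inr rfl), zero_add]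
        exact mul_le_of_le_one_left zero_le prob_le_one
      have hA' : η ∉ A ∪ {ξ} := fun h => h.elim hA hξ
      have h1 : R.law η {ω | ReachUpTo ξ A (n + 1) ω}
          = ∫⁻ ζ, R.law ζ {ω | ReachUpTo ξ A n ω} ∂(R.jumpKernel η) := by
        rw [R.law_apply η (measurableSet_reachUpTo ξ A (n + 1))]
        have : ∀ u : ℝ, {ω : ℕ → E × ℝ | consSeq (η, u) ω ∈ {ω | ReachUpTo ξ A (n + 1) ω}}
            = {ω | ReachUpTo ξ A n ω} := fun u => by
          ext ω
          exact reachUpTo_succ_consSeq ξ A hA hξ n ω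
        simp_rw [this]
        simp
      rw [R.meanOccUpTo_succ_of_notMem F hA', R.meanOcc_of_notMem F hA, h1, add_assoc,
        ← lintegral_mul_const _ Measurable.of_discrete, ← lintegral_add_right _ Measurable.of_discrete]
      gcongr with ζ
      exact ih ζ
  have hmono : Monotone fun n => {ω : ℕ → E × ℝ | ReachUpTo ξ A n ω} :=
    fun m n hmn ω ⟨k, hk, h⟩ => ⟨k, hk.trans_le hmn, h⟩
  rw [setOf_reach_eq_iUnion, hmono.measure_iUnion, R.meanOcc_eq_iSup, ENNReal.iSup_mul,
    ENNReal.iSup_add_iSup_of_monotone]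
  · exact iSup_le fun n => key n η
  · exact fun m n hmn => lintegral_mono (R.monotone_occUpTo _ F hmn)
  · exact fun m n hmn => mul_le_mul_left (measure_mono (hmono hmn)) _

end RateMatrix

/-! ### Geometric tails of occupation times -/

namespace RateMatrix

variable {E : Type*} (R : RateMatrix E)

lemma clock_add (η : E) {u s : ℝ} (hu : 0 ≤ u) (hs : 0 ≤ s) :
    R.clock (η, u + s) = R.clock (η, u) + R.clock (η, s) := by
  simp only [clock]
  rw [ENNReal.ofReal_add hu hs, ENNReal.add_div]

lemma clock_mul_holdingRate {η : E} (h : 0 < R.holdingRate η) (s : ℝ) :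
    R.clock (η, s * R.holdingRate η) = ENNReal.ofReal s := by
  simp only [clock]
  rw [ENNReal.ofReal_mul' h.le, ENNReal.mul_div_cancel_right (by simpa using h)
    ENNReal.ofReal_ne_top]

lemma holdingRate_nonneg (η : E) : 0 ≤ R.holdingRate η := by
  have := R.rate_diag_nonpos η
  unfold holdingRate
  linarith

lemma clock_of_absorbing {η : E} (h : R.holdingRate η = 0) {u : ℝ} (hu : 0 < u) :
    R.clock (η, u) = ∞ := by
  simp [clock, h, ENNReal.div_zero, hu]

lemma clock_mono (η : E) {u v : ℝ} (h : u ≤ v) : R.clock (η, u) ≤ R.clock (η, v) :=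
  ENNReal.div_le_div_right (ENNReal.ofReal_le_ofReal h) _

variable [Countable E] [MeasurableSpace E] [DiscreteMeasurableSpace E]

lemma law_lt_occUpTo_succ (A F : Set E) {η : E} (hA : η ∉ A) (n : ℕ) (t : ℝ≥0∞) :
    R.law η {ω | t < R.occUpTo A F (n + 1) ω}
      = ∫⁻ u, ∫⁻ ζ, R.law ζ {ω | t < F.indicator (fun _ => R.clock (η, u)) η + R.occUpTo A F n ω}
        ∂(R.jumpKernel η) ∂(expMeasure 1) := by
  rw [R.law_apply η (measurableSet_lt measurable_const (by fun_prop))]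
  have : ∀ u : ℝ, {ω : ℕ → E × ℝ | consSeq (η, u) ω ∈ {ω | t < R.occUpTo A F (n + 1) ω}}
      = {ω | t < F.indicator (fun _ => R.clock (η, u)) η + R.occUpTo A F n ω} := fun u => by
    ext ω
    change t < R.occUpTo A F (n + 1) (consSeq (η, u) ω) ↔ _
    rw [R.occUpTo_succ_consSeq A F (x := (η, u)) hA]
    rfl
  simp_rw [this]

lemma measurable_law_lt_clock_add {f : (ℕ → E × ℝ) → ℝ≥0∞} (hf : Measurable f) (η : E) (t : ℝ≥0∞) :
    Measurable fun u : ℝ => ∫⁻ ζ, R.law ζ {ω | t < R.clock (η, u) + f ω} ∂(R.jumpKernel η) := by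
  have h1 : ∀ u : ℝ, ∫⁻ ζ, R.law ζ {ω | t < R.clock (η, u) + f ω} ∂(R.jumpKernel η)
      = ∫⁻ ζ, R.lawKernel ζ
        (Prod.mk (u, ζ) ⁻¹' {p : (ℝ × E) × (ℕ → E × ℝ) | t < R.clock (η, p.1.1) + f p.2})
        ∂(R.jumpKernel η) := fun u => rfl
  simp_rw [h1]
  have h2 : Measurable fun p : ℝ × E => R.lawKernel p.2
      (Prod.mk p ⁻¹' {p : (ℝ × E) × (ℕ → E × ℝ) | t < R.clock (η, p.1.1) + f p.2}) :=
    Kernel.measurable_kernel_prodMk_left (κ := R.lawKernel.comap Prod.snd measurable_snd)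
      (measurableSet_lt measurable_const (by fun_prop))
  exact h2.lintegral_prod_right'

/-- The tail of the time spent in `F` before `A` is submultiplicative, up to replacing one factor by
the worst case over the starting points in `F`. -/
lemma law_add_lt_occUpTo_le (A F : Set E) {t q : ℝ≥0∞}
    (hq : ∀ ζ ∈ F, R.law ζ {ω | t < R.occ A F ω} ≤ q) (n : ℕ) :
    ∀ (η : E) (s : ℝ≥0∞), R.law η {ω | s + t < R.occUpTo A F n ω}
      ≤ R.law η {ω | s < R.occUpTo A F n ω} * q := by
  induction n with
  | zero => intro η s; simp [occUpTo]
  | succ n ih =>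
    intro η s
    by_cases hs : s = ∞
    · simp [hs]
    by_cases ht : t = ∞
    · simp [ht]
    lift s to NNReal using hs
    by_cases hA : η ∈ A
    · have : R.law η {ω | (s : ℝ≥0∞) + t < R.occUpTo A F (n + 1) ω} = 0 := by
        rw [← compl_mem_ae_iff]
        filter_upwards [R.ae_law_zero η] with ω hω
        change ¬ ((s : ℝ≥0∞) + t < R.occUpTo A F (n + 1) ω)
        rw [R.occUpTo_of_mem (by rwa [hω])]
        simp
      rw [this]
      exact zero_le
    have hq1 : η ∈ F → R.law η {ω | t < R.occUpTo A F (n + 1) ω} ≤ q := fun hF =>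
      (measure_mono fun ω (h : _ < _) => h.trans_le (R.occUpTo_le_occ A F _ ω)).trans (hq η hF)
    rw [R.law_lt_occUpTo_succ A F hA] at hq1 ⊢
    rw [R.law_lt_occUpTo_succ A F hA]
    by_cases hF : η ∈ F
    swap
    · simp only [Set.indicator_of_notMem hF, zero_add, lintegral_const, measure_univ, mul_one]
      rw [← lintegral_mul_const _ Measurable.of_discrete]
      exact lintegral_mono fun ζ => ih ζ s
    replace hq1 := hq1 hF
    simp only [Set.indicator_of_mem hF] at hq1 ⊢
    -- From an absorbing point of `F` the time spent is infinite, so all the probabilities are one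
    -- and `hq` forces `1 ≤ q`.
    rcases (R.holdingRate_nonneg η).eq_or_lt with h0 | hpos
    · have hone : ∀ r : ℝ≥0∞, r ≠ ∞ → ∫⁻ u, ∫⁻ ζ, R.law ζ {ω | r < R.clock (η, u)
          + R.occUpTo A F n ω} ∂(R.jumpKernel η) ∂(expMeasure 1) = 1 := by
        intro r hr
        rw [lintegral_congr_ae (g := fun _ => 1)]
        · simp
        filter_upwards [ae_expMeasure_one_pos] with u hu
        simp [R.clock_of_absorbing h0.symm hu, hr.lt_top]
      rw [hone t ht] at hq1
      rw [hone _ (by finiteness), hone _ (by finiteness), one_mul]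
      exact hq1
    have hmt := R.measurable_law_lt_clock_add (R.measurable_occUpTo A F n) η t
    have hms := R.measurable_law_lt_clock_add (R.measurable_occUpTo A F n) η s
    have hmst := R.measurable_law_lt_clock_add (R.measurable_occUpTo A F n) η (s + t)
    -- The clock value for which the sojourn at `η` lasts exactly `s`. Beyond `σ` the level `s` is
    -- passed during the first sojourn, and memorylessness restarts the process at `η ∈ F`. Up to
    -- `σ` the first sojourn uses up part of `s`, and the induction hypothesis handles the remainder
    -- `s - R.clock (η, u)`.
    set σ : ℝ := s * R.holdingRate η with hσ
    have hσ0 : 0 ≤ σ := by positivity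
    have hcσ : R.clock (η, σ) = s := by
      rw [hσ, R.clock_mul_holdingRate hpos, ENNReal.ofReal_coe_nnreal]
    rw [← lintegral_add_compl (fun u => ∫⁻ ζ, R.law ζ {ω | (s : ℝ≥0∞) + t < R.clock (η, u)
        + R.occUpTo A F n ω} ∂(R.jumpKernel η)) (measurableSet_Ioi (a := σ)),
      ← lintegral_add_compl (fun u => ∫⁻ ζ, R.law ζ {ω | (s : ℝ≥0∞) < R.clock (η, u)
        + R.occUpTo A F n ω} ∂(R.jumpKernel η)) (measurableSet_Ioi (a := σ)), add_mul]
    refine add_le_add ?_ ?_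
    · rw [setLIntegral_Ioi_expMeasure_one hσ0 hmst]
      have hone : ∫⁻ u in Set.Ioi σ, ∫⁻ ζ, R.law ζ {ω | (s : ℝ≥0∞) < R.clock (η, u)
          + R.occUpTo A F n ω} ∂(R.jumpKernel η) ∂(expMeasure 1) = expMeasure 1 (Set.Ioi σ) := by
        rw [setLIntegral_congr_fun (g := fun _ => 1) measurableSet_Ioi]
        · simp
        intro u hu
        have hlt : (s : ℝ≥0∞) < R.clock (η, u) := by
          rw [← hcσ]
          simp only [clock]
          refine ENNReal.div_lt_div_right ?_ ENNReal.ofReal_ne_top ?_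
          · simpa using hpos
          · exact (ENNReal.ofReal_lt_ofReal_iff (hσ0.trans_lt hu)).2 hu
        have : ∀ ω : ℕ → E × ℝ, (s : ℝ≥0∞) < R.clock (η, u) + R.occUpTo A F n ω :=
          fun ω => hlt.trans_le le_self_add
        simp [this]
      rw [hone]
      gcongr
      refine le_trans (le_of_eq ?_) hq1
      refine lintegral_congr_ae ?_
      filter_upwards [ae_expMeasure_one_pos] with u hu
      rw [R.clock_add η hu.le hσ0, hcσ]
      simp_rw [add_comm _ (s : ℝ≥0∞), add_assoc, ENNReal.add_lt_add_iff_left ENNReal.coe_ne_top]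
    · rw [← lintegral_mul_const _ hms]
      refine setLIntegral_mono (hms.mul_const q) fun u hu => ?_
      have hu : u ≤ σ := by simpa using hu
      have hle : R.clock (η, u) ≤ s := hcσ ▸ R.clock_mono η hu
      have hne : R.clock (η, u) ≠ ∞ := (hle.trans_lt ENNReal.coe_lt_top).ne
      rw [← lintegral_mul_const _ Measurable.of_discrete]
      refine lintegral_mono fun ζ => ?_
      have h := ih ζ (s - R.clock (η, u))
      have e1 : ∀ x : ℝ≥0∞, (s : ℝ≥0∞) + t < R.clock (η, u) + x ↔ s - R.clock (η, u) + t < x := by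
        intro x
        rw [← ENNReal.add_lt_add_iff_left (a := R.clock (η, u)) hne (b := s - R.clock (η, u) + t),
          ← add_assoc, add_tsub_cancel_of_le hle]
      have e2 : ∀ x : ℝ≥0∞, (s : ℝ≥0∞) < R.clock (η, u) + x ↔ s - R.clock (η, u) < x := by
        intro x
        rw [← ENNReal.add_lt_add_iff_left (a := R.clock (η, u)) hne (b := s - R.clock (η, u)),
          add_tsub_cancel_of_le hle]
      simp_rw [e1, e2]
      exact h

lemma law_add_lt_occ_le (A F : Set E) {t q : ℝ≥0∞}
    (hq : ∀ ζ ∈ F, R.law ζ {ω | t < R.occ A F ω} ≤ q) (η : E) (s : ℝ≥0∞) :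
    R.law η {ω | s + t < R.occ A F ω} ≤ R.law η {ω | s < R.occ A F ω} * q := by
  have h : ∀ r : ℝ≥0∞, R.law η {ω | r < R.occ A F ω}
      = ⨆ n, R.law η {ω | r < R.occUpTo A F n ω} := by
    intro r
    rw [← Monotone.measure_iUnion]
    · congr 1
      ext ω
      simp [occ_eq_iSup, lt_iSup_iff]
    · exact fun m n hmn ω (hω : _ < _) => hω.trans_le (R.monotone_occUpTo A F hmn ω)
  rw [h, h, ENNReal.iSup_mul]
  exact iSup_mono fun n => R.law_add_lt_occUpTo_le A F hq n η s

/-- Each further level `t` costs a factor `q`. The starting point is arbitrary, since the clock of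
time in `F` runs only once `F` is entered. -/
lemma law_mul_lt_occ_le (A F : Set E) {t q : ℝ≥0∞}
    (hq : ∀ ζ ∈ F, R.law ζ {ω | t < R.occ A F ω} ≤ q) (η : E) (k : ℕ) :
    R.law η {ω | k * t < R.occ A F ω} ≤ q ^ k := by
  induction k with
  | zero => simpa using prob_le_one
  | succ k ih =>
    rw [Nat.cast_succ, add_mul, one_mul, pow_succ]
    exact (R.law_add_lt_occ_le A F hq η _).trans (mul_le_mul_left ih q)

end RateMatrix

/-- The sum rounds `x` up to a multiple of `t`. The least `n` with `y < n * t` supplies `n` nonzero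
terms for each `y < x`. -/
lemma le_tsum_indicator_mul_lt {t : ℝ≥0∞} (ht0 : t ≠ 0) (x : ℝ≥0∞) :
    x ≤ ∑' k : ℕ, {y : ℝ≥0∞ | k * t < y}.indicator (fun _ => t) x := by
  rw [ENNReal.tsum_eq_iSup_nat]
  refine le_of_forall_lt fun y hy => ?_
  obtain ⟨n, hn⟩ := ENNReal.exists_nat_mul_gt ht0 (hy.trans_le le_top).ne
  have hex : ∃ n : ℕ, y < n * t := ⟨n, hn⟩
  classical
  have hfind := Nat.find_spec hex
  refine hfind.trans_le (le_trans ?_ (le_iSup _ (Nat.find hex)))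
  rw [Finset.sum_congr rfl (g := fun _ => t)]
  · simp
  intro k hk
  have hk' := Nat.find_min hex (Finset.mem_range.1 hk)
  have hmem : x ∈ {y : ℝ≥0∞ | k * t < y} := (not_lt.1 hk').trans_lt hy
  exact Set.indicator_of_mem hmem _

/-- Rounding the occupation time up to multiples of `t` bounds its mean by a geometric series in
`q`. -/
lemma RateMatrix.meanOcc_le_of_tail {E : Type*} (R : RateMatrix E) [Countable E]
    [MeasurableSpace E] [DiscreteMeasurableSpace E] (A F : Set E) {t q : ℝ≥0∞}
    (ht0 : t ≠ 0) (hq : ∀ ζ ∈ F, R.law ζ {ω | t < R.occ A F ω} ≤ q) (η : E) :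
    R.meanOcc A F η ≤ t * (1 - q)⁻¹ := by
  have hm : ∀ k : ℕ, MeasurableSet {ω : ℕ → E × ℝ | k * t < R.occ A F ω} := fun k =>
    measurableSet_lt measurable_const (R.measurable_occ A F)
  calc R.meanOcc A F η
      ≤ ∫⁻ ω, ∑' k : ℕ, {ω | k * t < R.occ A F ω}.indicator (fun _ => t) ω ∂(R.law η) :=
        lintegral_mono fun ω => le_tsum_indicator_mul_lt ht0 _
    _ = ∑' k : ℕ, t * R.law η {ω | k * t < R.occ A F ω} := by
        rw [lintegral_tsum fun k => (measurable_const.indicator (hm k)).aemeasurable]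
        simp_rw [lintegral_indicator_const (hm _)]
    _ ≤ ∑' k : ℕ, t * q ^ k :=
        ENNReal.tsum_le_tsum fun k => mul_le_mul_right (R.law_mul_lt_occ_le A F hq η k) t
    _ = t * (1 - q)⁻¹ := by rw [ENNReal.tsum_mul_left, ENNReal.tsum_geometric]

/-! ### From the continuous-time path to the sojourns -/

lemma volume_ofReal_between {a b : ℝ≥0∞} (hab : a ≤ b) :
    volume {s : ℝ | 0 < s ∧ a ≤ ENNReal.ofReal s ∧ ENNReal.ofReal s < b} = b - a := by
  by_cases ha : a = ∞
  · subst ha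
    simp
  lift a to NNReal using ha
  by_cases hb : b = ∞
  · subst hb
    rw [ENNReal.top_sub_coe, eq_top_iff]
    refine (Real.volume_Ioi (a := (a : ℝ))).symm.le.trans ?_
    refine measure_mono fun s (hs : (a : ℝ) < s) => ?_
    have hs0 : 0 < s := a.coe_nonneg.trans_lt hs
    refine ⟨hs0, ?_, ENNReal.ofReal_lt_top⟩
    rw [← ENNReal.ofReal_coe_nnreal]
    exact ENNReal.ofReal_le_ofReal hs.le
  lift b to NNReal using hb
  have key : ∀ s : ℝ, 0 < s → (((a : ℝ≥0∞) ≤ ENNReal.ofReal s ∧ ENNReal.ofReal s < b)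
      ↔ (a : ℝ) ≤ s ∧ s < b) := by
    intro s hs
    rw [← ENNReal.ofReal_coe_nnreal (p := a), ← ENNReal.ofReal_coe_nnreal (p := b),
      ENNReal.ofReal_le_ofReal_iff hs.le, ENNReal.ofReal_lt_ofReal_iff_of_nonneg hs.le]
  have hv : ENNReal.ofReal ((b : ℝ) - a) = (b : ℝ≥0∞) - a := by
    rw [ENNReal.ofReal_sub _ a.coe_nonneg]
    simp
  refine le_antisymm ?_ ?_
  · rw [← hv, ← Real.volume_Ico]
    exact measure_mono fun s hs => (key s hs.1).1 hs.2
  · rw [← hv, ← Real.volume_Ioo]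
    refine measure_mono fun s hs => ?_
    have hs0 : 0 < s := a.coe_nonneg.trans_lt hs.1
    exact ⟨hs0, (key s hs0).2 ⟨hs.1.le, hs.2⟩⟩

lemma hittingTime_eq_timeSpent {E : Type*} (A : Set E) (e : ℝ → E) :
    hittingTime A e = timeSpent A Set.univ e := by
  have := volume_ofReal_between (zero_le (a := hittingTime A e))
  simp only [zero_le, true_and, tsub_zero] at this
  simp [timeSpent, this]

namespace RateMatrix

variable {E : Type*} (R : RateMatrix E)

/-- The time of the `n`-th jump. -/
def jumpTime (ω : ℕ → E × ℝ) (n : ℕ) : ℝ≥0∞ := ∑ k ∈ Finset.range n, R.holdingTime ω k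

/-- The number of jumps up to time `s`. -/
def jumpIndex (ω : ℕ → E × ℝ) (s : ℝ) : ℕ :=
  sInf {n : ℕ | ENNReal.ofReal s < R.jumpTime ω (n + 1)}

lemma path_eq (ω : ℕ → E × ℝ) (s : ℝ) : R.path ω s = (ω (R.jumpIndex ω s)).1 := rfl

lemma jumpTime_succ (ω : ℕ → E × ℝ) (n : ℕ) :
    R.jumpTime ω (n + 1) = R.jumpTime ω n + R.holdingTime ω n := Finset.sum_range_succ _ _

lemma monotone_jumpTime (ω : ℕ → E × ℝ) : Monotone (R.jumpTime ω) := fun _ _ h =>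
  Finset.sum_le_sum_of_subset (Finset.range_mono h)

/-- The regularity properties that almost every sample sequence has. -/
structure IsRegular (ω : ℕ → E × ℝ) : Prop where
  clock_pos : ∀ k, 0 < (ω k).2
  tsum_eq_top : ∑' n, R.holdingTime ω n = ∞
  absorbed : ∀ k, R.holdingRate (ω k).1 = 0 → (ω (k + 1)).1 = (ω k).1

variable {R} {ω : ℕ → E × ℝ}

namespace IsRegular

lemma lt_jumpTime_jumpIndex (h : R.IsRegular ω) (s : ℝ) :
    ENNReal.ofReal s < R.jumpTime ω (R.jumpIndex ω s + 1) := by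
  have hne : {n : ℕ | ENNReal.ofReal s < R.jumpTime ω (n + 1)}.Nonempty := by
    have ht := h.tsum_eq_top
    rw [ENNReal.tsum_eq_iSup_nat] at ht
    obtain ⟨n, hn⟩ := lt_iSup_iff.1 (ht.symm ▸ ENNReal.ofReal_lt_top (r := s))
    exact ⟨n, lt_of_lt_of_le hn (R.monotone_jumpTime ω n.le_succ)⟩
  exact Nat.sInf_mem hne

lemma jumpTime_le_of_lt_jumpIndex {n : ℕ} {s : ℝ} (hn : n < R.jumpIndex ω s) :
    R.jumpTime ω (n + 1) ≤ ENNReal.ofReal s :=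
  not_lt.1 (Nat.notMem_of_lt_sInf hn)

lemma jumpTime_le_of_le_jumpIndex {n : ℕ} {s : ℝ} (hn : n ≤ R.jumpIndex ω s) :
    R.jumpTime ω n ≤ ENNReal.ofReal s := by
  cases n with
  | zero => simp [jumpTime]
  | succ n => exact jumpTime_le_of_lt_jumpIndex hn

/-- Non-explosion keeps `jumpIndex` from being the default value of an infimum over the empty set,
so the half-open sojourn intervals cover all times. -/
lemma jumpIndex_eq_iff (h : R.IsRegular ω) (s : ℝ) (k : ℕ) :
    R.jumpIndex ω s = k
      ↔ R.jumpTime ω k ≤ ENNReal.ofReal s ∧ ENNReal.ofReal s < R.jumpTime ω (k + 1) := by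
  constructor
  · rintro rfl
    exact ⟨jumpTime_le_of_le_jumpIndex le_rfl, h.lt_jumpTime_jumpIndex s⟩
  · rintro ⟨h1, h2⟩
    refine le_antisymm (Nat.sInf_le h2) (not_lt.1 fun hlt => ?_)
    exact absurd ((h.lt_jumpTime_jumpIndex s).trans_le (R.monotone_jumpTime ω hlt)) h1.not_gt

lemma holdingTime_pos (h : R.IsRegular ω) (k : ℕ) : 0 < R.holdingTime ω k :=
  ENNReal.div_pos (by simpa using h.clock_pos k) ENNReal.ofReal_ne_top

lemma holdingRate_eq_zero {k : ℕ} (hk : R.holdingTime ω k = ∞) : R.holdingRate (ω k).1 = 0 := by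
  by_contra hne
  have hpos := lt_of_le_of_ne (R.holdingRate_nonneg _) (Ne.symm hne)
  exact (ENNReal.div_lt_top ENNReal.ofReal_ne_top (by simpa using hpos)).ne hk

/-- A state visited by the chain is occupied at some positive time, because every holding time is
positive. In particular the restriction `0 < s` in `hittingTime` does not hide a start in `A`. -/
lemma lt_hittingTime_iff (h : R.IsRegular ω) (A : Set E) {s : ℝ} (hs : 0 < s) :
    ENNReal.ofReal s < hittingTime A (R.path ω) ↔ ∀ j ≤ R.jumpIndex ω s, (ω j).1 ∉ A := by
  constructor
  · intro hlt j hj hA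
    refine absurd hlt (not_lt.2 ?_)
    have hJ := jumpTime_le_of_le_jumpIndex hj
    rcases lt_or_ge (ENNReal.ofReal s) (R.jumpTime ω (j + 1)) with h1 | h1
    · have hi : R.jumpIndex ω s = j := (h.jumpIndex_eq_iff s j).2 ⟨hJ, h1⟩
      exact iInf_le_of_le s (iInf_le_of_le hs (iInf_le_of_le (by rw [path_eq, hi]; exact hA) le_rfl))
    · have hlt' : R.jumpTime ω j < R.jumpTime ω (j + 1) := by
        rw [jumpTime_succ]
        exact ENNReal.lt_add_right (hJ.trans_lt ENNReal.ofReal_lt_top).ne (h.holdingTime_pos j).ne'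
      -- A time strictly inside the `j`-th sojourn; strictness on the left makes it positive even
      -- for `j = 0`.
      obtain ⟨r, _, hr1, hr2⟩ := ENNReal.lt_iff_exists_real_btwn.1 hlt'
      have hr0 : 0 < r := ENNReal.ofReal_pos.1 (zero_le.trans_lt hr1)
      have hi : R.jumpIndex ω r = j := (h.jumpIndex_eq_iff r j).2 ⟨hr1.le, hr2⟩
      exact iInf_le_of_le r (iInf_le_of_le hr0 (iInf_le_of_le (by rw [path_eq, hi]; exact hA)
        (hr2.le.trans h1)))
  · intro hA
    refine (h.lt_jumpTime_jumpIndex s).trans_le ?_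
    refine le_iInf fun r => le_iInf fun _ => le_iInf fun hr => ?_
    rw [path_eq] at hr
    exact jumpTime_le_of_lt_jumpIndex (not_le.1 fun hle => hA _ hle hr)

lemma state_eq_of_le (h : R.IsRegular ω) {m k : ℕ} (hm : R.holdingTime ω m = ∞) (hk : m ≤ k) :
    (ω k).1 = (ω m).1 := by
  induction k, hk using Nat.le_induction with
  | base => rfl
  | succ k hk ih => rw [h.absorbed k (by rw [ih]; exact holdingRate_eq_zero hm), ih]

/-- The two series can differ termwise only after a first infinite holding time `m`, where the
truncated difference `∞ - ∞` is `0`. The chain is then frozen in an absorbing state: if `m` counts,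
both sums are infinite; if not, no later index counts. -/
lemma tsum_mul_jumpTime_sub (h : R.IsRegular ω) (A F : Set E) :
    ∑' k, {k | (∀ j ≤ k, (ω j).1 ∉ A) ∧ (ω k).1 ∈ F}.indicator
      (fun k => R.jumpTime ω (k + 1) - R.jumpTime ω k) k = R.occ A F ω := by
  set G : Set ℕ := {k | (∀ j ≤ k, (ω j).1 ∉ A) ∧ (ω k).1 ∈ F} with hG
  have hocc : ∀ k, R.occTerm A F k ω = G.indicator (R.holdingTime ω) k := by
    intro k
    by_cases hk : k ∈ G
    · rw [Set.indicator_of_mem hk]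
      exact R.occTerm_of_pos hk
    · rw [Set.indicator_of_notMem hk]
      exact R.occTerm_of_neg hk
  have hfin : ∀ k, R.jumpTime ω k ≠ ∞ →
      R.jumpTime ω (k + 1) - R.jumpTime ω k = R.holdingTime ω k := by
    intro k hk
    rw [jumpTime_succ, ENNReal.add_sub_cancel_left hk]
  have hJ : ∀ k, (∀ j < k, R.holdingTime ω j ≠ ∞) → R.jumpTime ω k ≠ ∞ := fun k hk =>
    ENNReal.sum_ne_top.2 fun j hj => hk j (Finset.mem_range.1 hj)
  simp only [occ, hocc]
  by_cases hex : ∃ m, R.holdingTime ω m = ∞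
  swap
  · push Not at hex
    refine tsum_congr fun k => ?_
    simp only [Set.indicator, hfin k (hJ k fun j _ => hex j)]
  classical
  set m := Nat.find hex with hm
  have hmt : R.holdingTime ω m = ∞ := Nat.find_spec hex
  have hJm : ∀ k ≤ m, R.jumpTime ω k ≠ ∞ := fun k hk =>
    hJ k fun j hj => Nat.find_min hex (hj.trans_le hk)
  by_cases hmG : m ∈ G
  · rw [ENNReal.tsum_eq_top_of_eq_top ⟨m, ?_⟩, ENNReal.tsum_eq_top_of_eq_top ⟨m, ?_⟩]
    · rw [Set.indicator_of_mem hmG, hmt]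
    · rw [Set.indicator_of_mem hmG, hfin m (hJm m le_rfl), hmt]
  · refine tsum_congr fun k => ?_
    rcases le_or_gt k m with hk | hk
    · by_cases hkG : k ∈ G
      · rw [Set.indicator_of_mem hkG, Set.indicator_of_mem hkG, hfin k (hJm k hk)]
      · rw [Set.indicator_of_notMem hkG, Set.indicator_of_notMem hkG]
    · have hkG : k ∉ G := by
        rintro ⟨h1, h2⟩
        exact hmG ⟨fun j hj => h1 j (hj.trans hk.le), by rwa [← h.state_eq_of_le hmt hk.le]⟩
      rw [Set.indicator_of_notMem hkG, Set.indicator_of_notMem hkG]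

/-- The time spent by the path is the sum of its sojourn times. -/
lemma timeSpent_path (h : R.IsRegular ω) (A F : Set E) : timeSpent A F (R.path ω) = R.occ A F ω := by
  set G : Set ℕ := {k | (∀ j ≤ k, (ω j).1 ∉ A) ∧ (ω k).1 ∈ F} with hG
  let I : ℕ → Set ℝ := fun k =>
    {s : ℝ | 0 < s ∧ R.jumpTime ω k ≤ ENNReal.ofReal s ∧ ENNReal.ofReal s < R.jumpTime ω (k + 1)}
  have hI : ∀ k, MeasurableSet (I k) := fun k =>
    (measurableSet_lt measurable_const measurable_id).inter
      ((measurableSet_le measurable_const ENNReal.measurable_ofReal).inter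
        (measurableSet_lt ENNReal.measurable_ofReal measurable_const))
  have hmeas : MeasurableSet {s : ℝ | 0 < s ∧ ENNReal.ofReal s < hittingTime A (R.path ω)} :=
    (measurableSet_lt measurable_const measurable_id).inter
      (measurableSet_lt ENNReal.measurable_ofReal measurable_const)
  -- At a positive time `s` exactly one sojourn interval contains `s`, namely that of `jumpIndex`.
  have hpt : ∀ s : ℝ, {s : ℝ | 0 < s ∧ ENNReal.ofReal s < hittingTime A (R.path ω)}.indicator
      (fun s => F.indicator (fun _ => (1 : ℝ≥0∞)) (R.path ω s)) s
      = ∑' k, G.indicator (fun k => (I k).indicator (fun _ => (1 : ℝ≥0∞)) s) k := by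
    intro s
    by_cases hs : 0 < s
    swap
    · rw [Set.indicator_of_notMem fun hmem => hs hmem.1]
      symm
      refine ENNReal.tsum_eq_zero.2 fun k => ?_
      have : s ∉ I k := fun hmem => hs hmem.1
      simp [Set.indicator, this]
    rw [tsum_eq_single (R.jumpIndex ω s)]
    · have hmem : s ∈ I (R.jumpIndex ω s) := ⟨hs, (h.jumpIndex_eq_iff s _).1 rfl⟩
      by_cases hA : ∀ j ≤ R.jumpIndex ω s, (ω j).1 ∉ A
      · have h1 : s ∈ {s : ℝ | 0 < s ∧ ENNReal.ofReal s < hittingTime A (R.path ω)} :=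
          ⟨hs, (h.lt_hittingTime_iff A hs).2 hA⟩
        rw [Set.indicator_of_mem h1]
        by_cases hF : R.path ω s ∈ F
        · have hGm : R.jumpIndex ω s ∈ G := ⟨hA, hF⟩
          rw [Set.indicator_of_mem hF, Set.indicator_of_mem hGm, Set.indicator_of_mem hmem]
        · have hGm : R.jumpIndex ω s ∉ G := fun h' => hF h'.2
          rw [Set.indicator_of_notMem hF, Set.indicator_of_notMem hGm]
      · have h1 : s ∉ {s : ℝ | 0 < s ∧ ENNReal.ofReal s < hittingTime A (R.path ω)} :=
          fun h' => hA ((h.lt_hittingTime_iff A hs).1 h'.2)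
        have hGm : R.jumpIndex ω s ∉ G := fun h' => hA h'.1
        rw [Set.indicator_of_notMem h1, Set.indicator_of_notMem hGm]
    · intro k hk
      have : s ∉ I k := fun hmem => hk ((h.jumpIndex_eq_iff s k).2 hmem.2).symm
      simp [Set.indicator, this]
  rw [timeSpent, ← lintegral_indicator hmeas, lintegral_congr hpt, lintegral_tsum]
  · rw [← h.tsum_mul_jumpTime_sub A F, ← hG]
    refine tsum_congr fun k => ?_
    by_cases hk : k ∈ G
    · simp only [Set.indicator_of_mem hk]
      rw [lintegral_indicator_const (hI k), one_mul,
        volume_ofReal_between (R.monotone_jumpTime ω k.le_succ)]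
    · simp only [Set.indicator_of_notMem hk, lintegral_zero]
  · intro k
    by_cases hk : k ∈ G
    · simp only [Set.indicator_of_mem hk]
      exact (measurable_const.indicator (hI k)).aemeasurable
    · simp only [Set.indicator_of_notMem hk]
      exact aemeasurable_const

lemma hittingTime_path (h : R.IsRegular ω) (A : Set E) : hittingTime A (R.path ω) = R.occ A Set.univ ω := by
  rw [hittingTime_eq_timeSpent, h.timeSpent_path]

end IsRegular

variable (R)
variable [Countable E] [MeasurableSpace E] [DiscreteMeasurableSpace E]

/-- An event that is almost sure from every starting point remains so after dropping the first `k`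
terms; this reduces properties of all indices to index zero. -/
lemma ae_law_shift {S : Set (ℕ → E × ℝ)} (hS : MeasurableSet S)
    (h : ∀ η, ∀ᵐ ω ∂(R.law η), ω ∈ S) (k : ℕ) :
    ∀ η, ∀ᵐ ω ∂(R.law η), (fun n => ω (n + k)) ∈ S := by
  induction k with
  | zero => exact h
  | succ k ih =>
    intro η
    have hm : MeasurableSet {ω : ℕ → E × ℝ | ¬ (fun n => ω (n + (k + 1))) ∈ S} :=
      ((measurable_pi_lambda (fun (ω : ℕ → E × ℝ) n => ω (n + (k + 1)))
        fun n => measurable_pi_apply _) hS).compl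
    rw [ae_iff, R.law_apply η hm]
    have : ∀ (u : ℝ) (ζ : E), R.law ζ {ω | consSeq (η, u) ω
        ∈ {ω : ℕ → E × ℝ | ¬ (fun n => ω (n + (k + 1))) ∈ S}} = 0 := fun u ζ => ae_iff.1 (ih ζ)
    rw [lintegral_congr fun u => lintegral_congr (this u)]
    simp

lemma ae_clock_pos (η : E) : ∀ᵐ ω ∂(R.law η), ∀ k, 0 < (ω k).2 := by
  rw [ae_all_iff]
  intro k
  have hS : MeasurableSet {ω : ℕ → E × ℝ | 0 < (ω 0).2} :=
    measurableSet_lt measurable_const (by fun_prop)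
  have h0 : ∀ η, ∀ᵐ ω ∂(R.law η), ω ∈ {ω : ℕ → E × ℝ | 0 < (ω 0).2} := by
    intro η
    change R.law η {ω : ℕ → E × ℝ | 0 < (ω 0).2}ᶜ = 0
    rw [R.law_apply η hS.compl,
      lintegral_congr_ae (g := fun _ => 0) ?_, lintegral_zero]
    filter_upwards [ae_expMeasure_one_pos] with u hu
    simp [hu]
  simpa using R.ae_law_shift hS h0 k η

lemma ae_jumpKernel_of_absorbing {η : E} (h : R.holdingRate η = 0) :
    ∀ᵐ ζ ∂(R.jumpKernel η), ζ = η := by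
  rw [ae_iff]
  change (R.jumpPMF η).toMeasure {ζ | ¬ ζ = η} = 0
  rw [PMF.toMeasure_apply_eq_zero_iff _ MeasurableSet.of_discrete, Set.disjoint_left]
  intro ζ hζ hne
  refine (PMF.mem_support_iff _ _).1 hζ ?_
  change ENNReal.ofReal (R.jumpProb η ζ) = 0
  have hne : ζ ≠ η := hne
  simp [jumpProb, h, hne]

lemma ae_absorbed (η : E) :
    ∀ᵐ ω ∂(R.law η), ∀ k, R.holdingRate (ω k).1 = 0 → (ω (k + 1)).1 = (ω k).1 := by
  rw [ae_all_iff]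
  intro k
  have hS : MeasurableSet
      {ω : ℕ → E × ℝ | R.holdingRate (ω 0).1 = 0 → (ω 1).1 = (ω 0).1} := by
    have hf : Measurable fun ω : ℕ → E × ℝ => ((ω 0).1, (ω 1).1) := by fun_prop
    exact hf (MeasurableSet.of_discrete (s := {p : E × E | R.holdingRate p.1 = 0 → p.2 = p.1}))
  have h0 : ∀ η, ∀ᵐ ω ∂(R.law η),
      ω ∈ {ω : ℕ → E × ℝ | R.holdingRate (ω 0).1 = 0 → (ω 1).1 = (ω 0).1} := by
    intro η
    change R.law η {ω : ℕ → E × ℝ | R.holdingRate (ω 0).1 = 0 → (ω 1).1 = (ω 0).1}ᶜ = 0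
    rw [R.law_apply η hS.compl, lintegral_congr (g := fun _ => 0), lintegral_zero]
    intro u
    by_cases hη : R.holdingRate η = 0
    swap
    · simp [hη]
    rw [lintegral_congr_ae (g := fun _ => 0) ?_, lintegral_zero]
    filter_upwards [R.ae_jumpKernel_of_absorbing hη] with ζ hζ
    subst hζ
    rw [← compl_mem_ae_iff]
    filter_upwards [R.ae_law_zero ζ] with ω hω hmem
    exact hmem fun _ => hω
  filter_upwards [R.ae_law_shift hS h0 k η] with ω hω
  simpa [add_comm] using hω

lemma NonExplosive.ae_isRegular {R : RateMatrix E} (hR : R.NonExplosive) (η : E) :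
    ∀ᵐ ω ∂(R.law η), R.IsRegular ω := by
  filter_upwards [R.ae_clock_pos η, hR η, R.ae_absorbed η] with ω h1 h2 h3
  exact ⟨h1, h2, h3⟩

lemma NonExplosive.meanTimeSpent_eq {R : RateMatrix E} (hR : R.NonExplosive) (η : E)
    (A F : Set E) : R.meanTimeSpent η A F = R.meanOcc A F η := by
  refine lintegral_congr_ae ?_
  filter_upwards [hR.ae_isRegular η] with ω hω using hω.timeSpent_path A F

end RateMatrix

/-! ### Convergence to the exponential law through tails -/

section Tails

variable {Ω : ℕ → Type*} [∀ N, MeasurableSpace (Ω N)] {μ : ∀ N, Measure (Ω N)}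

/-- The tails of the random variables `X N` converge to those of the mean-one exponential
distribution. -/
def TailsToExp (μ : ∀ N, Measure (Ω N)) (X : ∀ N, Ω N → ℝ≥0∞) : Prop :=
  ∀ t : ℝ, 0 < t → Tendsto (fun N => μ N {ω | ENNReal.ofReal t < X N ω}) atTop
    (𝓝 (ENNReal.ofReal (Real.exp (-t))))

/-- The random variables `X N` converge to zero in probability. -/
def ToZeroInProb (μ : ∀ N, Measure (Ω N)) (X : ∀ N, Ω N → ℝ≥0∞) : Prop :=
  ∀ δ : ℝ, 0 < δ → Tendsto (fun N => μ N {ω | ENNReal.ofReal δ < X N ω}) atTop (𝓝 0)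

lemma map_ofReal_expMeasure_Ioi {t : ℝ} (ht : 0 ≤ t) :
    (expMeasure 1).map ENNReal.ofReal (Set.Ioi (ENNReal.ofReal t))
      = ENNReal.ofReal (Real.exp (-t)) := by
  rw [Measure.map_apply ENNReal.measurable_ofReal measurableSet_Ioi, ← expMeasure_one_Ioi ht]
  congr 1
  ext u
  exact ENNReal.ofReal_lt_ofReal_iff_of_nonneg ht

lemma map_ofReal_expMeasure_singleton {t : ℝ} (ht : 0 < t) :
    (expMeasure 1).map ENNReal.ofReal {ENNReal.ofReal t} = 0 := by
  rw [Measure.map_apply ENNReal.measurable_ofReal (measurableSet_singleton _)]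
  have hsub : ENNReal.ofReal ⁻¹' {ENNReal.ofReal t} ⊆ {t} := by
    intro u hu
    have hu : ENNReal.ofReal u = ENNReal.ofReal t := hu
    have hu0 : 0 < u := ENNReal.ofReal_pos.1 (hu ▸ ENNReal.ofReal_pos.2 ht)
    exact (ENNReal.ofReal_eq_ofReal_iff hu0.le ht.le).1 hu
  have hac : expMeasure 1 ≪ volume := withDensity_absolutelyContinuous _ _
  exact measure_mono_null hsub (hac (by simp))

/-- A criterion for weak convergence on `[0, ∞]` in terms of tails. -/
lemma tendsto_probabilityMeasure_of_tails {ν : ℕ → ProbabilityMeasure ℝ≥0∞}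
    {ρ : ProbabilityMeasure ℝ≥0∞}
    (h : ∀ a : EReal, Tendsto (fun N => (ν N : Measure ℝ≥0∞) {x : ℝ≥0∞ | a < (x : EReal)}) atTop
      (𝓝 ((ρ : Measure ℝ≥0∞) {x : ℝ≥0∞ | a < (x : EReal)}))) :
    Tendsto ν atTop (𝓝 ρ) := by
  have hm : ∀ a : EReal, MeasurableSet {x : ℝ≥0∞ | a < (x : EReal)} := fun a =>
    measurableSet_lt measurable_const measurable_coe_ennreal_ereal
  -- Endpoints are taken in `EReal` so that a left endpoint strictly below `0` is available;
  -- half-open intervals are then neighbourhoods of `0` too.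
  let S : Set (Set ℝ≥0∞) := {s | ∃ a b : EReal, s = {x : ℝ≥0∞ | a < (x : EReal) ∧ (x : EReal) ≤ b}}
  have hdiff : ∀ a b : EReal, {x : ℝ≥0∞ | a < (x : EReal) ∧ (x : EReal) ≤ b}
      = {x : ℝ≥0∞ | a < (x : EReal)} \ {x : ℝ≥0∞ | max a b < (x : EReal)} := by
    intro a b
    ext x
    simp only [Set.mem_sdiff, Set.mem_ofPred_eq, max_lt_iff, not_and, not_lt]
    exact ⟨fun hx => ⟨hx.1, fun _ => hx.2⟩, fun hx => ⟨hx.1, hx.2 hx.1⟩⟩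
  refine IsPiSystem.tendsto_probabilityMeasure_of_tendsto_of_mem (S := S) ?_ ?_ ?_ ?_
  · rintro _ ⟨a, b, rfl⟩ _ ⟨a', b', rfl⟩ _
    refine ⟨max a a', min b b', ?_⟩
    ext x
    simp only [Set.mem_inter_iff, Set.mem_ofPred_eq, max_lt_iff, le_min_iff]
    tauto
  · rintro _ ⟨a, b, rfl⟩
    rw [hdiff]
    exact (hm a).diff (hm _)
  · intro u hu x hx
    have hux : u ∈ 𝓝 x := hu.mem_nhds hx
    rw [EReal.isEmbedding_coe_ennreal.nhds_eq_comap, mem_comap] at hux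
    obtain ⟨v, hv, hvu⟩ := hux
    have hbot : (⊥ : EReal) < (x : EReal) := EReal.bot_lt_coe_ennreal x
    obtain ⟨a, ha, hav⟩ := exists_Ioc_subset_of_mem_nhds hv ⟨⊥, hbot⟩
    by_cases htop : (x : EReal) = ⊤
    · refine ⟨_, ⟨a, ⊤, rfl⟩, ?_, fun y hy => hvu (hav ⟨hy.1, htop ▸ hy.2⟩)⟩
      have : {y : ℝ≥0∞ | a < (y : EReal) ∧ (y : EReal) ≤ ⊤}
          = {y : ℝ≥0∞ | a < (y : EReal)} := by
        ext y
        simp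
      rw [this]
      exact (isOpen_lt continuous_const continuous_coe_ennreal_ereal).mem_nhds ha
    · obtain ⟨b, hb, hbv⟩ := exists_Ico_subset_of_mem_nhds hv ⟨⊤, lt_of_le_of_ne le_top htop⟩
      obtain ⟨c, hc1, hc2⟩ := exists_between hb
      refine ⟨_, ⟨a, c, rfl⟩, ?_, fun y hy => hvu ?_⟩
      · have ho : IsOpen {y : ℝ≥0∞ | a < (y : EReal) ∧ (y : EReal) < c} :=
          (isOpen_lt continuous_const continuous_coe_ennreal_ereal).inter
            (isOpen_lt continuous_coe_ennreal_ereal continuous_const)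
        exact mem_of_superset (ho.mem_nhds ⟨ha, hc1⟩) fun y hy => ⟨hy.1, hy.2.le⟩
      · rcases le_or_gt (y : EReal) (x : EReal) with hyx | hyx
        · exact hav ⟨hy.1, hyx⟩
        · exact hbv ⟨hyx.le, hy.2.trans_lt hc2⟩
  · rintro _ ⟨a, b, rfl⟩
    have hsub : {x : ℝ≥0∞ | max a b < (x : EReal)} ⊆ {x : ℝ≥0∞ | a < (x : EReal)} :=
      fun x hx => lt_of_le_of_lt (le_max_left a b) (show max a b < (x : EReal) from hx)
    have key : ∀ ρ : ProbabilityMeasure ℝ≥0∞,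
        ρ {x : ℝ≥0∞ | a < (x : EReal) ∧ (x : EReal) ≤ b}
          = ρ {x : ℝ≥0∞ | a < (x : EReal)} - ρ {x : ℝ≥0∞ | max a b < (x : EReal)} := by
      intro ρ
      rw [hdiff]
      apply ENNReal.coe_injective
      rw [ENNReal.coe_sub]
      simp only [ProbabilityMeasure.ennreal_coeFn_eq_coeFn_toMeasure]
      exact measure_sdiff hsub (hm _).nullMeasurableSet (measure_ne_top _ _)
    have h' : ∀ a : EReal, Tendsto (fun N => ν N {x : ℝ≥0∞ | a < (x : EReal)}) atTop
        (𝓝 (ρ {x : ℝ≥0∞ | a < (x : EReal)})) := fun a => by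
      rw [← ENNReal.tendsto_coe]
      simpa only [ProbabilityMeasure.ennreal_coeFn_eq_coeFn_toMeasure] using h a
    simp_rw [key]
    exact (h' a).sub (h' _)

lemma tendstoInDistribution_exp_iff [∀ N, IsProbabilityMeasure (μ N)] {X : ∀ N, Ω N → ℝ≥0∞}
    (hX : ∀ N, AEMeasurable (X N) (μ N)) :
    TendstoInDistribution X atTop ENNReal.ofReal μ (expMeasure 1) ↔ TailsToExp μ X := by
  have hpre : ∀ N t, (μ N).map (X N) (Set.Ioi t) = μ N {ω | t < X N ω} := fun N t =>
    Measure.map_apply_of_aemeasurable (hX N) measurableSet_Ioi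
  constructor
  · intro h t ht
    have h1 := ProbabilityMeasure.tendsto_measure_of_null_frontier_of_tendsto' h.tendsto
      (E := Set.Ioi (ENNReal.ofReal t)) ?_
    · change Tendsto (fun N => (μ N).map (X N) (Set.Ioi (ENNReal.ofReal t))) atTop
        (𝓝 ((expMeasure 1).map ENNReal.ofReal (Set.Ioi (ENNReal.ofReal t)))) at h1
      simpa only [hpre, map_ofReal_expMeasure_Ioi ht.le] using h1
    · exact measure_mono_null
        (frontier_Ioi' ⟨∞, ENNReal.ofReal_lt_top⟩ : frontier (Set.Ioi (ENNReal.ofReal t)) = _).le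
        (map_ofReal_expMeasure_singleton ht)
  · intro h
    refine ⟨hX, ENNReal.measurable_ofReal.aemeasurable, tendsto_probabilityMeasure_of_tails ?_⟩
    intro a
    change Tendsto (fun N => (μ N).map (X N) {x : ℝ≥0∞ | a < (x : EReal)}) atTop
      (𝓝 ((expMeasure 1).map ENNReal.ofReal {x : ℝ≥0∞ | a < (x : EReal)}))
    rcases lt_or_ge a 0 with ha | ha
    · have : {x : ℝ≥0∞ | a < (x : EReal)} = Set.univ :=
        Set.eq_univ_of_forall fun x => ha.trans_le (EReal.coe_ennreal_nonneg x)
      have hp : ∀ N, IsProbabilityMeasure ((μ N).map (X N)) := fun N =>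
        Measure.isProbabilityMeasure_map (hX N)
      have hp' : IsProbabilityMeasure ((expMeasure 1).map ENNReal.ofReal) :=
        Measure.isProbabilityMeasure_map ENNReal.measurable_ofReal.aemeasurable
      simp [this]
    · have hset : {x : ℝ≥0∞ | a < (x : EReal)} = Set.Ioi a.toENNReal := by
        ext x
        rw [Set.mem_ofPred_eq, Set.mem_Ioi, ← EReal.coe_ennreal_lt_coe_ennreal_iff,
          EReal.coe_toENNReal ha]
      rw [hset]
      simp only [hpre]
      generalize a.toENNReal = b
      by_cases hb : b = ∞
      · subst hb
        simp
      rw [← ENNReal.ofReal_toReal hb]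
      rcases (ENNReal.toReal_nonneg (a := b)).eq_or_lt with h0 | h0
      swap
      · rw [map_ofReal_expMeasure_Ioi h0.le]
        exact h _ h0
      rw [← h0, map_ofReal_expMeasure_Ioi le_rfl, neg_zero, Real.exp_zero, ENNReal.ofReal_one]
      -- `TailsToExp` says nothing at `t = 0`; there the tail is at least the one at a small
      -- positive `t`, whose limit is close to one.
      refine tendsto_order.2 ⟨fun c hc => ?_, fun c hc => Eventually.of_forall fun N =>
        prob_le_one.trans_lt hc⟩
      have hcont : Tendsto (fun t : ℝ => ENNReal.ofReal (Real.exp (-t))) (𝓝[>] 0) (𝓝 1) := by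
        have : Continuous fun t : ℝ => ENNReal.ofReal (Real.exp (-t)) :=
          ENNReal.continuous_ofReal.comp (by fun_prop)
        simpa using (this.tendsto 0).mono_left nhdsWithin_le_nhds
      obtain ⟨t, hct, ht⟩ := ((hcont.eventually_const_lt hc).and self_mem_nhdsWithin).exists
      filter_upwards [(h t ht).eventually_const_lt hct] with N hN
      refine hN.trans_le (measure_mono fun ω hω => ?_)
      refine lt_of_le_of_lt ?_ (show ENNReal.ofReal t < X N ω from hω)
      exact ENNReal.ofReal_le_ofReal (le_of_lt ht)

/-- Exponential limiting tails are stable under perturbations that are small in probability. -/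
lemma TailsToExp.perturb {X Y : ∀ N, Ω N → ℝ≥0∞} (hX : TailsToExp μ X)
    (h1 : ∀ s t : ℝ, 0 < s → s < t → Tendsto (fun N => μ N
      {ω | ENNReal.ofReal t < Y N ω ∧ X N ω ≤ ENNReal.ofReal s}) atTop (𝓝 0))
    (h2 : ∀ s t : ℝ, 0 < s → s < t → Tendsto (fun N => μ N
      {ω | ENNReal.ofReal t < X N ω ∧ Y N ω ≤ ENNReal.ofReal s}) atTop (𝓝 0)) :
    TailsToExp μ Y := by
  intro t ht
  have hcont : Tendsto (fun t : ℝ => ENNReal.ofReal (Real.exp (-t))) (𝓝 t)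
      (𝓝 (ENNReal.ofReal (Real.exp (-t)))) := by
    have : Continuous fun t : ℝ => ENNReal.ofReal (Real.exp (-t)) :=
      ENNReal.continuous_ofReal.comp (by fun_prop)
    exact this.tendsto t
  -- For `s < t < t'` the tail of `Y` at `t` lies, up to vanishing errors, between those of `X` at
  -- `t'` and at `s`; continuity of the exponential closes the gap.
  refine tendsto_order.2 ⟨fun a ha => ?_, fun b hb => ?_⟩
  · obtain ⟨t', hat, ht'⟩ := (((hcont.mono_left nhdsWithin_le_nhds).eventually_const_lt ha).and
      (self_mem_nhdsWithin (s := Set.Ioi t))).exists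
    have ht' : t < t' := ht'
    have hlim := ENNReal.Tendsto.sub (hX t' (ht.trans ht')) (h2 t t' ht ht')
      (Or.inl ENNReal.ofReal_ne_top)
    rw [tsub_zero] at hlim
    filter_upwards [hlim.eventually_const_lt hat] with N hN
    refine hN.trans_le (tsub_le_iff_right.2 ((measure_mono fun ω hω => ?_).trans
      (measure_union_le _ _)))
    rcases lt_or_ge (ENNReal.ofReal t) (Y N ω) with h | h
    · exact Or.inl h
    · exact Or.inr ⟨hω, h⟩
  · have hev : ∀ᶠ s in 𝓝[<] t, s ∈ Set.Ioo 0 t := Ioo_mem_nhdsLT ht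
    obtain ⟨s, hsb, hs0, hst⟩ :=
      (((hcont.mono_left nhdsWithin_le_nhds).eventually_lt_const hb).and hev).exists
    have hlim := (hX s hs0).add (h1 s t hs0 hst)
    rw [add_zero] at hlim
    filter_upwards [hlim.eventually_lt_const hsb] with N hN
    refine ((measure_mono fun ω hω => ?_).trans (measure_union_le _ _)).trans_lt hN
    rcases lt_or_ge (ENNReal.ofReal s) (X N ω) with h | h
    · exact Or.inl h
    · exact Or.inr ⟨hω, h⟩

/-- For `X + Z` to exceed `t` while `X ≤ s`, the term `Z` must exceed `t - s`. -/
lemma tendsto_measure_zero_of_le_add {X Y Z : ∀ N, Ω N → ℝ≥0∞} (hZ : ToZeroInProb μ Z)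
    (h : ∀ N ω, Y N ω ≤ X N ω + Z N ω) (s t : ℝ) (hs : 0 < s) (hst : s < t) :
    Tendsto (fun N => μ N {ω | ENNReal.ofReal t < Y N ω ∧ X N ω ≤ ENNReal.ofReal s})
      atTop (𝓝 0) := by
  refine tendsto_of_tendsto_of_tendsto_of_le_of_le tendsto_const_nhds (hZ (t - s) (sub_pos.2 hst))
    (fun _ => zero_le) fun N => measure_mono fun ω hω => ?_
  change ENNReal.ofReal (t - s) < Z N ω
  rw [ENNReal.ofReal_sub _ hs.le]
  refine ENNReal.sub_lt_of_lt_add (ENNReal.ofReal_le_ofReal hst.le) (hω.1.trans_le ((h N ω).trans ?_))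
  rw [add_comm]
  gcongr
  exact hω.2

lemma TailsToExp.of_add {X Z : ∀ N, Ω N → ℝ≥0∞}
    (h : TailsToExp μ fun N ω => X N ω + Z N ω) (hZ : ToZeroInProb μ Z) : TailsToExp μ X :=
  h.perturb
    (fun s t hs hst => tendsto_measure_zero_of_le_add hZ
      (fun _ _ => le_self_add.trans le_self_add) s t hs hst)
    (fun s t hs hst => tendsto_measure_zero_of_le_add hZ (fun _ _ => le_rfl) s t hs hst)

lemma TailsToExp.add {X Z : ∀ N, Ω N → ℝ≥0∞}
    (h : TailsToExp μ X) (hZ : ToZeroInProb μ Z) : TailsToExp μ fun N ω => X N ω + Z N ω :=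
  h.perturb
    (fun s t hs hst => tendsto_measure_zero_of_le_add hZ (fun _ _ => le_rfl) s t hs hst)
    (fun s t hs hst => tendsto_measure_zero_of_le_add hZ
      (fun _ _ => le_self_add.trans le_self_add) s t hs hst)

/-- Once `c N` lies strictly between `s / t` and `t / s`, the exceptional events of
`TailsToExp.perturb` are empty. -/
lemma TailsToExp.mul_of_tendsto_one {X Y : ∀ N, Ω N → ℝ≥0∞} {c : ℕ → ℝ≥0∞}
    (h : TailsToExp μ X) (hc : Tendsto c atTop (𝓝 1))
    (hY : ∀ᶠ N in atTop, ∀ ω, Y N ω = X N ω * c N) : TailsToExp μ Y := by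
  refine h.perturb (fun s t hs hst => ?_) (fun s t hs hst => ?_)
  · have hlt : (1 : ℝ≥0∞) < ENNReal.ofReal (t / s) := by
      rw [← ENNReal.ofReal_one]
      exact (ENNReal.ofReal_lt_ofReal_iff (div_pos (hs.trans hst) hs)).2 ((one_lt_div hs).2 hst)
    refine tendsto_const_nhds.congr' ?_
    filter_upwards [hc.eventually_lt_const hlt, hY] with N hN hYN
    symm
    rw [measure_eq_zero_iff_ae_notMem]
    refine Eventually.of_forall fun ω hω => ?_
    refine absurd hω.1 (not_lt.2 ?_)
    rw [hYN]
    calc X N ω * c N ≤ ENNReal.ofReal s * ENNReal.ofReal (t / s) := mul_le_mul' hω.2 hN.le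
      _ = ENNReal.ofReal t := by
        rw [← ENNReal.ofReal_mul hs.le, mul_div_cancel₀ _ hs.ne']
  · have hlt : ENNReal.ofReal (s / t) < 1 := by
      rw [← ENNReal.ofReal_one]
      exact (ENNReal.ofReal_lt_ofReal_iff one_pos).2 ((div_lt_one (hs.trans hst)).2 hst)
    have ht := hs.trans hst
    refine tendsto_const_nhds.congr' ?_
    filter_upwards [hc.eventually_const_lt hlt, hY,
      hc.eventually_lt_const ENNReal.one_lt_top] with N hN hYN hfin
    symm
    rw [measure_eq_zero_iff_ae_notMem]
    refine Eventually.of_forall fun ω hω => ?_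
    refine absurd hω.2 (not_le.2 ?_)
    rw [hYN]
    calc ENNReal.ofReal s = ENNReal.ofReal t * ENNReal.ofReal (s / t) := by
          rw [← ENNReal.ofReal_mul ht.le, mul_div_cancel₀ _ ht.ne']
      _ < X N ω * c N := ENNReal.mul_lt_mul hω.1 hN

lemma ToZeroInProb.mul_of_tendsto_one {X Y : ∀ N, Ω N → ℝ≥0∞} {c : ℕ → ℝ≥0∞}
    (h : ToZeroInProb μ X) (hc : Tendsto c atTop (𝓝 1))
    (hY : ∀ᶠ N in atTop, ∀ ω, Y N ω = X N ω * c N) : ToZeroInProb μ Y := by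
  intro δ hδ
  refine tendsto_of_tendsto_of_tendsto_of_le_of_le' tendsto_const_nhds (h (δ / 2) (half_pos hδ))
    (Eventually.of_forall fun _ => zero_le) ?_
  filter_upwards [hc.eventually_lt_const (ENNReal.one_lt_two), hY] with N hN hYN
  refine measure_mono fun ω hω => ?_
  change ENNReal.ofReal (δ / 2) < X N ω
  refine not_le.1 fun hle => absurd (show ENNReal.ofReal δ < Y N ω from hω) (not_lt.2 ?_)
  rw [hYN]
  calc X N ω * c N ≤ ENNReal.ofReal (δ / 2) * 2 := mul_le_mul' hle hN.le
    _ = ENNReal.ofReal δ := by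
      rw [← ENNReal.ofReal_ofNat, ← ENNReal.ofReal_mul (by positivity)]
      congr 1
      ring

/-- The layer cake formula for `[0, ∞]`-valued functions. -/
lemma lintegral_eq_lintegral_tail {Ω : Type*} [MeasurableSpace Ω] (μ : Measure Ω) [SFinite μ]
    {X : Ω → ℝ≥0∞} (hX : Measurable X) :
    ∫⁻ ω, X ω ∂μ = ∫⁻ t in Set.Ioi (0 : ℝ), μ {ω | ENNReal.ofReal t < X ω} := by
  have h1 : ∀ x : ℝ≥0∞, x = ∫⁻ t in Set.Ioi (0 : ℝ),
      (Set.Iio x).indicator (fun _ => (1 : ℝ≥0∞)) (ENNReal.ofReal t) := by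
    intro x
    have hv := volume_ofReal_between (zero_le (a := x))
    simp only [zero_le, true_and, tsub_zero] at hv
    have hm : MeasurableSet {t : ℝ | ENNReal.ofReal t < x} :=
      measurableSet_lt ENNReal.measurable_ofReal measurable_const
    have : ∀ t : ℝ, (Set.Iio x).indicator (fun _ => (1 : ℝ≥0∞)) (ENNReal.ofReal t)
        = {t : ℝ | ENNReal.ofReal t < x}.indicator (fun _ => (1 : ℝ≥0∞)) t := fun t => rfl
    simp_rw [this]
    rw [lintegral_indicator_const hm, Measure.restrict_apply hm, one_mul]
    conv_lhs => rw [← hv]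
    congr 1
    ext t
    exact and_comm
  have hS : MeasurableSet {p : Ω × ℝ | ENNReal.ofReal p.2 < X p.1} :=
    measurableSet_lt (by fun_prop) (by fun_prop)
  calc ∫⁻ ω, X ω ∂μ = ∫⁻ ω, (∫⁻ t in Set.Ioi (0 : ℝ),
        {p : Ω × ℝ | ENNReal.ofReal p.2 < X p.1}.indicator (fun _ => (1 : ℝ≥0∞)) (ω, t)) ∂μ :=
        lintegral_congr fun ω => h1 (X ω)
    _ = ∫⁻ t in Set.Ioi (0 : ℝ), ∫⁻ ω,
        {p : Ω × ℝ | ENNReal.ofReal p.2 < X p.1}.indicator (fun _ => (1 : ℝ≥0∞)) (ω, t) ∂μ :=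
        lintegral_lintegral_swap (measurable_const.indicator hS).aemeasurable
    _ = _ := by
        refine lintegral_congr fun t => ?_
        exact lintegral_indicator_one
          (measurableSet_lt measurable_const hX : MeasurableSet {ω | ENNReal.ofReal t < X ω})

lemma lintegral_Ioi_ofReal_exp_neg :
    ∫⁻ t in Set.Ioi (0 : ℝ), ENNReal.ofReal (Real.exp (-t)) = 1 := by
  rw [← ofReal_integral_eq_lintegral_ofReal]
  · rw [integral_exp_neg_Ioi_zero, ENNReal.ofReal_one]
  · simpa [IntegrableOn] using exp_neg_integrableOn_Ioi 0 one_pos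
  · exact Eventually.of_forall fun t => (Real.exp_pos _).le

/-- Turns a geometric bound at integers into an integrable dominating function, using `1 / 2 ≤ exp
(-1 / 2)`; the factor `2` pays for rounding down. -/
lemma half_pow_floor_le (t : ℝ) :
    (1 / 2 : ℝ≥0∞) ^ ⌊t⌋₊ ≤ 2 * ENNReal.ofReal (Real.exp (-(1 / 2) * t)) := by
  have hreal : (1 / 2 : ℝ) ^ ⌊t⌋₊ ≤ 2 * Real.exp (-(1 / 2) * t) := by
    have h1 : (1 / 2 : ℝ) ≤ Real.exp (-(1 / 2)) := by
      have := Real.add_one_le_exp (-(1 / 2))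
      linarith
    have h2 : t < ⌊t⌋₊ + 1 := Nat.lt_floor_add_one t
    calc (1 / 2 : ℝ) ^ ⌊t⌋₊ = 2 * (1 / 2 : ℝ) ^ (⌊t⌋₊ + 1) := by rw [pow_succ]; ring
      _ ≤ 2 * Real.exp (-(1 / 2)) ^ (⌊t⌋₊ + 1) := by gcongr
      _ = 2 * Real.exp (-(1 / 2) * (⌊t⌋₊ + 1)) := by
        rw [← Real.exp_nat_mul]
        push_cast
        ring_nf
      _ ≤ 2 * Real.exp (-(1 / 2) * t) := by
        gcongr 2 * Real.exp ?_
        linarith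
  have := ENNReal.ofReal_le_ofReal hreal
  rw [ENNReal.ofReal_pow (by norm_num), ENNReal.ofReal_mul (by norm_num)] at this
  simpa [ENNReal.ofReal_div_of_pos] using this

/-- Under a uniform geometric bound on the tails, the means converge as well. -/
lemma TailsToExp.tendsto_lintegral [∀ N, SFinite (μ N)] {X : ∀ N, Ω N → ℝ≥0∞}
    (hX : ∀ N, Measurable (X N)) (h : TailsToExp μ X)
    (hb : ∀ᶠ N in atTop, ∀ k : ℕ, μ N {ω | (k : ℝ≥0∞) < X N ω} ≤ (1 / 2) ^ k) :
    Tendsto (fun N => ∫⁻ ω, X N ω ∂(μ N)) atTop (𝓝 1) := by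
  simp_rw [fun N => lintegral_eq_lintegral_tail (μ N) (hX N)]
  rw [← lintegral_Ioi_ofReal_exp_neg]
  refine tendsto_lintegral_filter_of_dominated_convergence
    (fun t => 2 * ENNReal.ofReal (Real.exp (-(1 / 2) * t))) ?_ ?_ ?_ ?_
  · refine Eventually.of_forall fun N => Antitone.measurable fun s t hst => ?_
    exact measure_mono fun ω hω => lt_of_le_of_lt (ENNReal.ofReal_le_ofReal hst) hω
  · filter_upwards [hb] with N hN
    refine (ae_restrict_iff' measurableSet_Ioi).2 (Eventually.of_forall fun t ht => ?_)
    have ht : 0 < t := ht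
    refine le_trans (measure_mono fun ω hω => ?_) ((hN ⌊t⌋₊).trans (half_pow_floor_le t))
    refine lt_of_le_of_lt ?_ (show ENNReal.ofReal t < X N ω from hω)
    rw [← ENNReal.ofReal_natCast]
    exact ENNReal.ofReal_le_ofReal (Nat.floor_le ht.le)
  · rw [lintegral_const_mul _ (by fun_prop)]
    refine ENNReal.mul_ne_top (by simp) ?_
    exact (exp_neg_integrableOn_Ioi 0 (by norm_num : (0 : ℝ) < 1 / 2)).lintegral_lt_top.ne
  · exact (ae_restrict_iff' measurableSet_Ioi).2 (Eventually.of_forall fun t ht => h t ht)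

end Tails

/-! ### Uniformity on the well and comparison of occupation times -/

/-- A property that holds eventually along every sequence of points of `W` holds eventually
uniformly on `W`. -/
lemma eventually_forall_mem {E : ℕ → Type*} {W : ∀ N, Set (E N)} {ξ : ∀ N, E N}
    (hξ : ∀ N, ξ N ∈ W N) {P : ∀ N, E N → Prop}
    (h : ∀ η : ∀ N, E N, (∀ N, η N ∈ W N) → ∀ᶠ N in atTop, P N (η N)) :
    ∀ᶠ N in atTop, ∀ ζ ∈ W N, P N ζ := by
  -- Choose a counterexample whenever there is one, and `ξ N` otherwise; along this sequence the
  -- property implies its uniform version.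
  have hch : ∀ N, ∃ ζ ∈ W N, P N ζ → ∀ ζ' ∈ W N, P N ζ' := by
    intro N
    by_cases hN : ∀ ζ ∈ W N, P N ζ
    · exact ⟨ξ N, hξ N, fun _ => hN⟩
    · push Not at hN
      obtain ⟨ζ, hζ, hP⟩ := hN
      exact ⟨ζ, hζ, fun h' => absurd h' hP⟩
  choose η hη hP using hch
  filter_upwards [h η hη] with N hN using hP N hN

namespace RateMatrix

variable {E : Type*} {R : RateMatrix E}

lemma occ_univ_eq_add (W B : Set E) (ω : ℕ → E × ℝ) :
    R.occ Bᶜ Set.univ ω = R.occ Bᶜ W ω + R.occ Bᶜ (B \ W) ω := by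
  rw [occ, occ, occ, ← ENNReal.tsum_add]
  refine tsum_congr fun k => ?_
  by_cases hA : ∀ j ≤ k, (ω j).1 ∉ Bᶜ
  · have hB : (ω k).1 ∈ B := not_not.1 (hA k le_rfl)
    by_cases hW : (ω k).1 ∈ W
    · rw [R.occTerm_of_pos ⟨hA, Set.mem_univ _⟩, R.occTerm_of_pos ⟨hA, hW⟩,
        R.occTerm_of_neg (F := B \ W) fun h => h.2.2 hW, add_zero]
    · rw [R.occTerm_of_pos ⟨hA, Set.mem_univ _⟩, R.occTerm_of_neg (F := W) fun h => hW h.2,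
        R.occTerm_of_pos (F := B \ W) ⟨hA, ⟨hB, hW⟩⟩, zero_add]
  · rw [R.occTerm_of_neg fun h => hA h.1, R.occTerm_of_neg fun h => hA h.1,
      R.occTerm_of_neg fun h => hA h.1, add_zero]

/-- An earlier hitting time leaves less time to spend in any set; passing through the path makes
this comparison of integration domains immediate. -/
lemma IsRegular.occ_le_occ {ω : ℕ → E × ℝ} (h : R.IsRegular ω) {A A' : Set E} (F : Set E)
    (hle : R.occ A Set.univ ω ≤ R.occ A' Set.univ ω) : R.occ A F ω ≤ R.occ A' F ω := by
  rw [← h.hittingTime_path, ← h.hittingTime_path] at hle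
  rw [← h.timeSpent_path, ← h.timeSpent_path]
  exact lintegral_mono_set fun s hs => ⟨hs.1, hs.2.trans_le hle⟩

variable [Countable E] [MeasurableSpace E] [DiscreteMeasurableSpace E]

/-- Markov's inequality for the rescaled occupation time. -/
lemma law_lt_occ_div_le (A F : Set E) (η : E) {δ : ℝ} (hδ : 0 < δ) (c : ℝ≥0∞) :
    R.law η {ω | ENNReal.ofReal δ < R.occ A F ω / c}
      ≤ R.meanOcc A F η / c / ENNReal.ofReal δ := by
  have hm : Measurable fun ω => R.occ A F ω / c := (R.measurable_occ A F).div_const c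
  have h := meas_ge_le_lintegral_div (μ := R.law η) hm.aemeasurable
    (ENNReal.ofReal_pos.2 hδ).ne' ENNReal.ofReal_ne_top
  refine (measure_mono fun ω hω => ?_).trans (h.trans (le_of_eq ?_))
  · exact (show ENNReal.ofReal δ < R.occ A F ω / c from hω).le
  · simp only [div_eq_mul_inv]
    rw [lintegral_mul_const _ (R.measurable_occ A F)]
    rfl

end RateMatrix

/-! ### The two sets of conditions in terms of the jump chain -/

section Sequences

variable {E : ℕ → Type*} [∀ N, Countable (E N)] [∀ N, MeasurableSpace (E N)]
  [∀ N, DiscreteMeasurableSpace (E N)] {R : ∀ N, RateMatrix (E N)}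

/-- The laws `P_{η_N}`. -/
abbrev laws (R : ∀ N, RateMatrix (E N)) (η : ∀ N, E N) : ∀ N, Measure (ℕ → E N × ℝ) :=
  fun N => (R N).law (η N)

lemma convergesToExp_iff {η : ∀ N, E N} {X Y : ∀ N, (ℕ → E N × ℝ) → ℝ≥0∞}
    (hXY : ∀ N, X N =ᵐ[(R N).law (η N)] Y N) (hY : ∀ N, Measurable (Y N)) :
    ConvergesToExp R η X ↔ TailsToExp (laws R η) Y := by
  rw [ConvergesToExp, tendstoInDistribution_exp_iff fun N => ⟨Y N, hY N, hXY N⟩]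
  refine forall_congr' fun t => forall_congr' fun _ => ?_
  have : ∀ N, (R N).law (η N) {ω | ENNReal.ofReal t < X N ω}
      = (R N).law (η N) {ω | ENNReal.ofReal t < Y N ω} := fun N => by
    refine measure_congr ?_
    filter_upwards [hXY N] with ω hω
    change (ENNReal.ofReal t < X N ω) = (ENNReal.ofReal t < Y N ω)
    rw [hω]
  simp_rw [this]

variable {W B : ∀ N, Set (E N)} {ξ : ∀ N, E N}

lemma convergesToExp_timeSpent_iff (hR : ∀ N, (R N).NonExplosive)
    (η : ∀ N, E N) (A F : ∀ N, Set (E N)) (c : ℕ → ℝ≥0∞) :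
    ConvergesToExp R η (fun N ω => timeSpent (A N) (F N) ((R N).path ω) / c N)
      ↔ TailsToExp (laws R η) fun N ω => (R N).occ (A N) (F N) ω / c N := by
  refine convergesToExp_iff (fun N => ?_) fun N => ((R N).measurable_occ _ _).div_const _
  filter_upwards [(hR N).ae_isRegular (η N)] with ω hω
  rw [hω.timeSpent_path]

lemma toZeroInProb_timeSpent_iff (hR : ∀ N, (R N).NonExplosive)
    (η : ∀ N, E N) (A F : ∀ N, Set (E N)) (c : ℕ → ℝ≥0∞) :
    (∀ δ : ℝ, 0 < δ → Tendsto (fun N => (R N).law (η N)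
      {ω | ENNReal.ofReal δ < timeSpent (A N) (F N) ((R N).path ω) / c N}) atTop (𝓝 0))
      ↔ ToZeroInProb (laws R η) fun N ω => (R N).occ (A N) (F N) ω / c N := by
  refine forall_congr' fun δ => forall_congr' fun _ => ?_
  have : ∀ N, (R N).law (η N)
      {ω | ENNReal.ofReal δ < timeSpent (A N) (F N) ((R N).path ω) / c N}
      = (R N).law (η N) {ω | ENNReal.ofReal δ < (R N).occ (A N) (F N) ω / c N} := fun N => by
    refine measure_congr ?_
    filter_upwards [(hR N).ae_isRegular (η N)] with ω hω
    change (ENNReal.ofReal δ < timeSpent (A N) (F N) ((R N).path ω) / c N) = (_ < _)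
    rw [hω.timeSpent_path]
  simp_rw [this]

lemma isValley_iff (hR : ∀ N, (R N).NonExplosive)
    {θ : ℕ → ℝ} :
    IsValley R W B ξ θ ↔ (∀ N, 0 < θ N) ∧ ∀ η : ∀ N, E N, (∀ N, η N ∈ W N) →
      Tendsto (fun N => (R N).law (η N)
        {ω | (R N).occ {ξ N} Set.univ ω < (R N).occ (B N)ᶜ Set.univ ω}) atTop (𝓝 1) ∧
      TailsToExp (laws R η)
        (fun N ω => (R N).occ (B N)ᶜ Set.univ ω / ENNReal.ofReal (θ N)) ∧
      ToZeroInProb (laws R η)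
        (fun N ω => (R N).occ (B N)ᶜ (B N \ W N) ω / ENNReal.ofReal (θ N)) := by
  have h1 : ∀ (η : ∀ N, E N) N, (R N).law (η N)
      {ω | hittingTime {ξ N} ((R N).path ω) < hittingTime (B N)ᶜ ((R N).path ω)}
      = (R N).law (η N)
        {ω | (R N).occ {ξ N} Set.univ ω < (R N).occ (B N)ᶜ Set.univ ω} := fun η N => by
    refine measure_congr ?_
    filter_upwards [(hR N).ae_isRegular (η N)] with ω hω
    change (hittingTime {ξ N} ((R N).path ω) < hittingTime (B N)ᶜ ((R N).path ω)) = (_ < _)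
    rw [hω.hittingTime_path, hω.hittingTime_path]
  have h2 : ∀ η : ∀ N, E N, ConvergesToExp R η
      (fun N ω => hittingTime (B N)ᶜ ((R N).path ω) / ENNReal.ofReal (θ N))
      ↔ TailsToExp (laws R η)
        (fun N ω => (R N).occ (B N)ᶜ Set.univ ω / ENNReal.ofReal (θ N)) := fun η => by
    simp_rw [hittingTime_eq_timeSpent]
    exact convergesToExp_timeSpent_iff hR η _ _ _
  have h3 := fun η : ∀ N, E N => toZeroInProb_timeSpent_iff hR η (fun N => (B N)ᶜ)
    (fun N => B N \ W N) (fun N => ENNReal.ofReal (θ N))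
  constructor
  · intro h
    refine ⟨h.depth_pos, fun η hη => ⟨?_, (h2 η).1 (h.exit_exponential η hη),
      (h3 η).1 (h.annulus_negligible η hη)⟩⟩
    simpa only [h1] using h.attractor_first η hη
  · rintro ⟨h0, h⟩
    refine ⟨h0, fun η hη => ?_, fun η hη => (h2 η).2 (h η hη).2.1,
      fun η hη => (h3 η).2 (h η hη).2.2⟩
    simpa only [h1] using (h η hη).1

lemma occupationConditions_iff (hR : ∀ N, (R N).NonExplosive)
    {η : ∀ N, E N} :
    OccupationConditions R W B ξ η ↔
      (∀ᶠ N in atTop, (R N).meanOcc (B N)ᶜ (W N) (η N) < ∞) ∧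
      (∀ᶠ N in atTop, (R N).meanOcc {ξ N} (W N) (η N) < ∞) ∧
      Tendsto (fun N => (R N).meanOcc {ξ N} (W N) (η N) / (R N).meanOcc (B N)ᶜ (W N) (η N))
        atTop (𝓝 0) ∧
      TailsToExp (laws R η)
        (fun N ω => (R N).occ (B N)ᶜ (W N) ω / (R N).meanOcc (B N)ᶜ (W N) (η N)) ∧
      ToZeroInProb (laws R η)
        (fun N ω => (R N).occ (B N)ᶜ (B N \ W N) ω / (R N).meanOcc (B N)ᶜ (W N) (η N)) := by
  have hm : ∀ N A F, (R N).meanTimeSpent (η N) A F = (R N).meanOcc A F (η N) := fun N A F =>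
    (hR N).meanTimeSpent_eq _ A F
  have h2 := convergesToExp_timeSpent_iff hR η (fun N => (B N)ᶜ) W
    (fun N => (R N).meanOcc (B N)ᶜ (W N) (η N))
  have h3 := toZeroInProb_timeSpent_iff hR η (fun N => (B N)ᶜ) (fun N => B N \ W N)
    (fun N => (R N).meanOcc (B N)ᶜ (W N) (η N))
  rw [← h2, ← h3]
  constructor
  · rintro ⟨a, b, c, d, e⟩
    simp only [hm] at a b c d e
    exact ⟨a, b, c, d, e⟩
  · rintro ⟨a, b, c, d, e⟩
    constructor <;> simpa only [hm]

/-- If `ξ` is reached before `A` with high probability in continuous time, then so it is by the jump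
chain. -/
lemma tendsto_law_reach {η : ∀ N, E N} {A : ∀ N, Set (E N)}
    (h : Tendsto (fun N => (R N).law (η N)
      {ω | (R N).occ {ξ N} Set.univ ω < (R N).occ (A N) Set.univ ω}) atTop (𝓝 1)) :
    Tendsto (fun N => (R N).law (η N) {ω | RateMatrix.Reach (ξ N) (A N) ω}) atTop (𝓝 1) :=
  tendsto_of_tendsto_of_tendsto_of_le_of_le h tendsto_const_nhds
    (fun N => measure_mono fun ω hω => by
      by_contra hn
      exact absurd ((R N).occ_le_of_not_reach hn) (not_le.2 hω))
    (fun N => prob_le_one)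

end Sequences

/-- The limiting tail at one lies strictly below `1 / 2`, so the tails at one are eventually below
`1 / 2`: this is the ratio of the geometric bound. -/
lemma ofReal_exp_neg_one_lt_half : ENNReal.ofReal (Real.exp (-1)) < 1 / 2 := by
  have h : Real.exp (-1) < 1 / 2 := by
    have := Real.exp_neg_one_lt_d9
    linarith
  have := (ENNReal.ofReal_lt_ofReal_iff (by norm_num)).2 h
  simpa [ENNReal.ofReal_div_of_pos] using this

lemma div_eq_div_mul_div {a b : ℝ≥0∞} (x : ℝ≥0∞) (hb : b ≠ 0) (hb' : b ≠ ∞) :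
    x / a = x / b * (b / a) := by
  rw [div_eq_mul_inv, div_eq_mul_inv, div_eq_mul_inv, mul_assoc, ← mul_assoc b⁻¹,
    ENNReal.inv_mul_cancel hb hb', one_mul]

/-! ### The two implications -/

section Sequences

variable {E : ℕ → Type*} [∀ N, Countable (E N)] [∀ N, MeasurableSpace (E N)]
  [∀ N, DiscreteMeasurableSpace (E N)] {R : ∀ N, RateMatrix (E N)}
  {W B A F : ∀ N, Set (E N)} {ξ : ∀ N, E N} {θ : ℕ → ℝ}

/-- If the rescaled time spent in `W` has asymptotically exponential tails from every point of
`W`, then its mean converges to one. -/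
lemma tendsto_meanOcc_div_of_tails (hξ : ∀ N, ξ N ∈ W N) (hθ : ∀ N, 0 < θ N)
    (h : ∀ η : ∀ N, E N, (∀ N, η N ∈ W N) →
      TailsToExp (laws R η) fun N ω => (R N).occ (A N) (W N) ω / ENNReal.ofReal (θ N))
    {η : ∀ N, E N} (hη : ∀ N, η N ∈ W N) :
    Tendsto (fun N => (R N).meanOcc (A N) (W N) (η N) / ENNReal.ofReal (θ N)) atTop (𝓝 1) := by
  have hθ0 : ∀ N, ENNReal.ofReal (θ N) ≠ 0 := fun N => (ENNReal.ofReal_pos.2 (hθ N)).ne'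
  have hdiv : ∀ N (c x : ℝ≥0∞), c < x / ENNReal.ofReal (θ N) ↔ c * ENNReal.ofReal (θ N) < x :=
    fun N c x => ENNReal.lt_div_iff_mul_lt (Or.inl (hθ0 N)) (Or.inl ENNReal.ofReal_ne_top)
  have hunif : ∀ᶠ N in atTop, ∀ ζ ∈ W N,
      (R N).law ζ {ω | ENNReal.ofReal (θ N) < (R N).occ (A N) (W N) ω} ≤ 1 / 2 := by
    refine eventually_forall_mem hξ fun ζ hζ => ?_
    filter_upwards [(h ζ hζ 1 one_pos).eventually_lt_const ofReal_exp_neg_one_lt_half] with N hN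
    simp only [ENNReal.ofReal_one, hdiv, one_mul] at hN
    exact hN.le
  have hlim := (h η hη).tendsto_lintegral (fun N => ((R N).measurable_occ _ _).div_const _) ?_
  · refine hlim.congr fun N => ?_
    simp only [div_eq_mul_inv]
    rw [lintegral_mul_const _ ((R N).measurable_occ _ _)]
    rfl
  · filter_upwards [hunif] with N hN k
    simp only [hdiv]
    exact (R N).law_mul_lt_occ_le _ _ hN (η N) k

/-- If, from every point of `W`, the attractor is reached before `A` with high probability and the
mean time spent in `W` before `A` is asymptotically `θ`, then the mean time spent in `W` before
the attractor is negligible with respect to `θ`. -/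
lemma tendsto_meanOcc_attractor_div (hξ : ∀ N, ξ N ∈ W N) (hθ : ∀ N, 0 < θ N)
    (hreach : ∀ η : ∀ N, E N, (∀ N, η N ∈ W N) →
      Tendsto (fun N => (R N).law (η N) {ω | RateMatrix.Reach (ξ N) (A N) ω}) atTop (𝓝 1))
    (hmean : ∀ η : ∀ N, E N, (∀ N, η N ∈ W N) →
      Tendsto (fun N => (R N).meanOcc (A N) (W N) (η N) / ENNReal.ofReal (θ N)) atTop (𝓝 1))
    {η : ∀ N, E N} :
    Tendsto (fun N => (R N).meanOcc {ξ N} (W N) (η N) / ENNReal.ofReal (θ N)) atTop (𝓝 0) := by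
  have hθ0 : ∀ N, ENNReal.ofReal (θ N) ≠ 0 := fun N => (ENNReal.ofReal_pos.2 (hθ N)).ne'
  -- In the lower comparison the total and the part after the visit to `ξ` both tend to one after
  -- division by `θ`, which leaves nothing for the part before `A ∪ {ξ}`.
  have hunion : ∀ η : ∀ N, E N, (∀ N, η N ∈ W N) →
      Tendsto (fun N => (R N).meanOcc (A N ∪ {ξ N}) (W N) (η N) / ENNReal.ofReal (θ N))
        atTop (𝓝 0) := by
    intro η hη
    have hy : Tendsto (fun N => (R N).law (η N) {ω | RateMatrix.Reach (ξ N) (A N) ω}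
        * ((R N).meanOcc (A N) (W N) (ξ N) / ENNReal.ofReal (θ N))) atTop (𝓝 1) := by
      simpa using ENNReal.Tendsto.mul (hreach η hη) (by simp) (hmean ξ hξ) (by simp)
    have hsub := ENNReal.Tendsto.sub (hmean η hη) hy (Or.inl ENNReal.one_ne_top)
    rw [tsub_self] at hsub
    refine tendsto_of_tendsto_of_tendsto_of_le_of_le' tendsto_const_nhds hsub
      (Eventually.of_forall fun _ => zero_le) ?_
    filter_upwards [hy.eventually_lt_const ENNReal.one_lt_top] with N hN
    refine ENNReal.le_sub_of_add_le_right hN.ne ?_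
    rw [← mul_div_assoc, ← ENNReal.add_div]
    exact ENNReal.div_le_div_right ((R N).meanOcc_add_reach_le _ _ _ _) _
  -- Off an event of vanishing probability `ξ` precedes `A`, and then the time before `ξ` is at most
  -- the time before `A ∪ {ξ}`, whose mean is negligible.
  have hprob : ∀ δ : ℝ, 0 < δ → ∀ η : ∀ N, E N, (∀ N, η N ∈ W N) →
      Tendsto (fun N => (R N).law (η N)
        {ω | ENNReal.ofReal δ < (R N).occ {ξ N} (W N) ω / ENNReal.ofReal (θ N)}) atTop (𝓝 0) := by
    intro δ hδ η hη
    have h1 := ENNReal.Tendsto.sub tendsto_const_nhds (hreach η hη) (Or.inl ENNReal.one_ne_top)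
    have h2 := ENNReal.Tendsto.div_const (hunion η hη) (b := ENNReal.ofReal δ)
      (Or.inr (ENNReal.ofReal_pos.2 hδ).ne')
    have h3 := h1.add h2
    rw [tsub_self, ENNReal.zero_div, add_zero] at h3
    refine tendsto_of_tendsto_of_tendsto_of_le_of_le tendsto_const_nhds h3 (fun _ => zero_le)
      fun N => ?_
    have hc := prob_compl_eq_one_sub (μ := (R N).law (η N))
      (RateMatrix.measurableSet_reach (ξ N) (A N))
    refine le_trans (le_trans (measure_mono fun ω hω => ?_) (measure_union_le
      {ω | RateMatrix.Reach (ξ N) (A N) ω}ᶜ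
      {ω | ENNReal.ofReal δ < (R N).occ (A N ∪ {ξ N}) (W N) ω / ENNReal.ofReal (θ N)}))
      (add_le_add hc.le (RateMatrix.law_lt_occ_div_le _ _ _ hδ _))
    by_cases hr : RateMatrix.Reach (ξ N) (A N) ω
    · refine Or.inr (lt_of_lt_of_le (show ENNReal.ofReal δ < _ from hω) ?_)
      exact ENNReal.div_le_div_right ((R N).occ_le_of_reach hr) _
    · exact Or.inl hr
  refine ENNReal.tendsto_nhds_zero.2 fun ε hε => ?_
  obtain ⟨δ, hδ, hδε⟩ : ∃ δ : ℝ, 0 < δ ∧ ENNReal.ofReal δ * 2 ≤ ε := by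
    obtain ⟨δ, hδ0, hδ1, hδ2⟩ := ENNReal.lt_iff_exists_real_btwn.1 (ENNReal.half_pos hε.ne')
    refine ⟨δ, ENNReal.ofReal_pos.1 hδ1, ?_⟩
    rw [← ENNReal.le_div_iff_mul_le (Or.inl two_ne_zero) (Or.inl ENNReal.ofNat_ne_top)]
    exact hδ2.le
  have hunif : ∀ᶠ N in atTop, ∀ ζ ∈ W N,
      (R N).law ζ {ω | ENNReal.ofReal δ * ENNReal.ofReal (θ N) < (R N).occ {ξ N} (W N) ω}
        ≤ 1 / 2 := by
    refine eventually_forall_mem hξ fun ζ hζ => ?_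
    have hhalf : (0 : ℝ≥0∞) < 1 / 2 := by simp
    filter_upwards [(hprob δ hδ ζ hζ).eventually_lt_const hhalf] with N hN
    simp only [ENNReal.lt_div_iff_mul_lt (Or.inl (hθ0 N)) (Or.inl ENNReal.ofReal_ne_top)] at hN
    exact hN.le
  filter_upwards [hunif] with N hN
  -- With tail bound `1 / 2` at level `δ θ` the mean is at most `2 δ θ`; this is where convergence
  -- in probability becomes convergence of means.
  have hb := (R N).meanOcc_le_of_tail {ξ N} (W N)
    (mul_ne_zero (ENNReal.ofReal_pos.2 hδ).ne' (hθ0 N)) hN (η N)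
  rw [one_div, ENNReal.one_sub_inv_two, inv_inv] at hb
  refine le_trans ?_ hδε
  rw [ENNReal.div_le_iff (hθ0 N) ENNReal.ofReal_ne_top]
  exact hb.trans_eq (by ring)

/-- The limits are first obtained with the normalisation `θ`; as the mean is asymptotic to `θ`,
dividing by the mean instead changes nothing. -/
lemma IsValley.occupationConditions (hR : ∀ N, (R N).NonExplosive)
    (hξ : ∀ N, ξ N ∈ W N) (h : IsValley R W B ξ θ) {η : ∀ N, E N} (hη : ∀ N, η N ∈ W N) :
    OccupationConditions R W B ξ η ∧
      Tendsto (fun N => (R N).meanOcc (B N)ᶜ (W N) (η N) / ENNReal.ofReal (θ N))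
        atTop (𝓝 1) := by
  obtain ⟨hθ, hV⟩ := (isValley_iff hR).1 h
  have hθ0 : ∀ N, ENNReal.ofReal (θ N) ≠ 0 := fun N => (ENNReal.ofReal_pos.2 (hθ N)).ne'
  have htails : ∀ η : ∀ N, E N, (∀ N, η N ∈ W N) → TailsToExp (laws R η)
      fun N ω => (R N).occ (B N)ᶜ (W N) ω / ENNReal.ofReal (θ N) := by
    intro η hη
    refine TailsToExp.of_add ?_ (hV η hη).2.2
    have := (hV η hη).2.1
    simpa only [RateMatrix.occ_univ_eq_add (W _), ENNReal.add_div] using this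
  have hmean := fun (η : ∀ N, E N) (hη : ∀ N, η N ∈ W N) =>
    tendsto_meanOcc_div_of_tails hξ hθ htails hη
  have hattr := tendsto_meanOcc_attractor_div hξ hθ
    (fun η hη => tendsto_law_reach (hV η hη).1) hmean (η := η)
  have hinv : Tendsto (fun N => ENNReal.ofReal (θ N) / (R N).meanOcc (B N)ᶜ (W N) (η N))
      atTop (𝓝 1) := by
    have := (hmean η hη).inv
    rw [inv_one] at this
    refine this.congr fun N => ?_
    rw [ENNReal.inv_div (Or.inl ENNReal.ofReal_ne_top) (Or.inl (hθ0 N))]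
  have hfin : ∀ x : ℕ → ℝ≥0∞, ∀ a : ℝ≥0∞, a ≠ ∞ →
      Tendsto (fun N => x N / ENNReal.ofReal (θ N)) atTop (𝓝 a) → ∀ᶠ N in atTop, x N < ∞ := by
    intro x a ha hx
    filter_upwards [hx.eventually_lt_const ha.lt_top] with N hN
    refine lt_of_not_ge fun hge => ?_
    rw [top_le_iff.1 hge, ENNReal.top_div_of_ne_top ENNReal.ofReal_ne_top] at hN
    exact lt_irrefl _ hN
  refine ⟨(occupationConditions_iff hR).2 ⟨hfin _ 1 ENNReal.one_ne_top (hmean η hη),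
    hfin _ 0 ENNReal.zero_ne_top hattr, ?_, ?_, ?_⟩, hmean η hη⟩
  · have := ENNReal.Tendsto.mul hattr (by simp) hinv (by simp)
    rw [zero_mul] at this
    exact this.congr fun N => (div_eq_div_mul_div _ (hθ0 N) ENNReal.ofReal_ne_top).symm
  · exact (htails η hη).mul_of_tendsto_one hinv (Eventually.of_forall fun N ω =>
      div_eq_div_mul_div _ (hθ0 N) ENNReal.ofReal_ne_top)
  · exact (hV η hη).2.2.mul_of_tendsto_one hinv (Eventually.of_forall fun N ω =>
      div_eq_div_mul_div _ (hθ0 N) ENNReal.ofReal_ne_top)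

/-- The attractor is visited before `A` with high probability if the time spent in `W` before the
attractor is negligible with respect to the asymptotically exponential time spent before `A`. -/
lemma tendsto_law_attractor_first (hR : ∀ N, (R N).NonExplosive) {η : ∀ N, E N} {c : ℕ → ℝ≥0∞}
    (hT : TailsToExp (laws R η) fun N ω => (R N).occ (A N) (W N) ω / c N)
    (h0 : Tendsto (fun N => (R N).meanOcc {ξ N} (W N) (η N) / c N) atTop (𝓝 0)) :
    Tendsto (fun N => (R N).law (η N)
      {ω | (R N).occ {ξ N} Set.univ ω < (R N).occ (A N) Set.univ ω}) atTop (𝓝 1) := by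
  have hm : ∀ N, MeasurableSet
      {ω | (R N).occ {ξ N} Set.univ ω < (R N).occ (A N) Set.univ ω} := fun N =>
    measurableSet_lt ((R N).measurable_occ _ _) ((R N).measurable_occ _ _)
  have hcompl : Tendsto (fun N => (R N).law (η N)
      {ω | (R N).occ {ξ N} Set.univ ω < (R N).occ (A N) Set.univ ω}ᶜ) atTop (𝓝 0) := by
    refine ENNReal.tendsto_nhds_zero.2 fun ε hε => ?_
    obtain ⟨δ, _, hδ1, hδε⟩ := ENNReal.lt_iff_exists_real_btwn.1 hε
    have hδ : 0 < δ := ENNReal.ofReal_pos.1 hδ1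
    have h1 := ENNReal.Tendsto.sub tendsto_const_nhds (hT δ hδ) (Or.inl ENNReal.one_ne_top)
    have h2 := ENNReal.Tendsto.div_const h0 (b := ENNReal.ofReal δ) (Or.inr hδ1.ne')
    have h3 := h1.add h2
    rw [ENNReal.zero_div, add_zero] at h3
    -- `1 - exp (-δ) ≤ δ < ε` bounds the limiting probability that the time spent in `W` before `A`
    -- is at most `δ c`.
    have hlt : 1 - ENNReal.ofReal (Real.exp (-δ)) < ε := by
      refine lt_of_le_of_lt ?_ hδε
      rw [← ENNReal.ofReal_one, ← ENNReal.ofReal_sub _ (Real.exp_pos _).le]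
      refine ENNReal.ofReal_le_ofReal ?_
      have := Real.add_one_le_exp (-δ)
      linarith
    filter_upwards [h3.eventually_lt_const hlt] with N hN
    refine le_trans ?_ hN.le
    have hmD : MeasurableSet {ω | ENNReal.ofReal δ < (R N).occ (A N) (W N) ω / c N} :=
      measurableSet_lt measurable_const (((R N).measurable_occ _ _).div_const _)
    have hc := prob_compl_eq_one_sub (μ := (R N).law (η N)) hmD
    refine le_trans (le_trans (measure_mono_ae ?_) (measure_union_le
      {ω | ENNReal.ofReal δ < (R N).occ (A N) (W N) ω / c N}ᶜ
      {ω | ENNReal.ofReal δ < (R N).occ {ξ N} (W N) ω / c N}))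
      (add_le_add hc.le (RateMatrix.law_lt_occ_div_le _ _ _ hδ _))
    filter_upwards [(hR N).ae_isRegular (η N)] with ω hω hmem
    have hle := hω.occ_le_occ (W N) (not_lt.1 hmem)
    by_cases hD : ENNReal.ofReal δ < (R N).occ (A N) (W N) ω / c N
    · exact Or.inr (hD.trans_le (ENNReal.div_le_div_right hle _))
    · exact Or.inl hD
  have h := ENNReal.Tendsto.sub (tendsto_const_nhds (x := (1 : ℝ≥0∞))) hcompl
    (Or.inl ENNReal.one_ne_top)
  rw [tsub_zero] at h
  refine h.congr fun N => ?_
  rw [← prob_compl_eq_one_sub (hm N).compl, compl_compl]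

/-- If the mean vanished, the occupation time would be almost surely zero, and with `0 / 0 = 0` the
tail at one would be zero, whereas it tends to `exp (-1)`. -/
lemma OccupationConditions.eventually_meanOcc_ne_zero (hR : ∀ N, (R N).NonExplosive)
    {η : ∀ N, E N} (h : OccupationConditions R W B ξ η) :
    ∀ᶠ N in atTop, (R N).meanOcc (B N)ᶜ (W N) (η N) ≠ 0 := by
  have hT := ((occupationConditions_iff hR).1 h).2.2.2.1 1 one_pos
  filter_upwards [hT.eventually_const_lt (ENNReal.ofReal_pos.2 (Real.exp_pos _))] with N hN h0
  refine hN.ne' ?_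
  rw [← compl_mem_ae_iff]
  have hae := (lintegral_eq_zero_iff ((R N).measurable_occ (B N)ᶜ (W N))).1 h0
  filter_upwards [hae] with ω hω
  change ¬ (ENNReal.ofReal 1 < (R N).occ (B N)ᶜ (W N) ω / _)
  rw [hω]
  simp

/-- The reciprocal ratio is squeezed: the upper comparison bounds it below by one minus the quotient
in (i), the lower comparison bounds it above by the inverse of the probability of reaching `ξ`
before leaving `B`. -/
lemma OccupationConditions.tendsto_meanOcc_div (hR : ∀ N, (R N).NonExplosive)
    {η : ∀ N, E N} (h : OccupationConditions R W B ξ η) :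
    Tendsto (fun N => (R N).meanOcc (B N)ᶜ (W N) (η N) / (R N).meanOcc (B N)ᶜ (W N) (ξ N))
      atTop (𝓝 1) := by
  have hne := h.eventually_meanOcc_ne_zero hR
  obtain ⟨hfin, -, hattr, hT, -⟩ := (occupationConditions_iff hR).1 h
  have hreach := tendsto_law_reach (tendsto_law_attractor_first hR hT hattr)
  have hlow := ENNReal.Tendsto.sub (tendsto_const_nhds (x := (1 : ℝ≥0∞))) hattr
    (Or.inl ENNReal.one_ne_top)
  rw [tsub_zero] at hlow
  have hup := hreach.inv
  rw [inv_one] at hup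
  have hratio : Tendsto (fun N =>
      (R N).meanOcc (B N)ᶜ (W N) (ξ N) / (R N).meanOcc (B N)ᶜ (W N) (η N)) atTop (𝓝 1) := by
    refine tendsto_of_tendsto_of_tendsto_of_le_of_le' hlow hup ?_ ?_
    · filter_upwards [hne, hfin] with N h0 h1
      rw [tsub_le_iff_left, ← ENNReal.add_div, ENNReal.le_div_iff_mul_le (Or.inl h0) (Or.inl h1.ne),
        one_mul]
      exact (R N).meanOcc_le_add _ _ _ _
    · filter_upwards [hne, hfin, hreach.eventually_const_lt one_pos] with N h0 h1 h2
      rw [ENNReal.div_le_iff h0 h1.ne, ← ENNReal.mul_le_iff_le_inv h2.ne' (measure_ne_top _ _)]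
      exact le_add_self.trans ((R N).meanOcc_add_reach_le _ _ _ _)
  have hinv := hratio.inv
  rw [inv_one] at hinv
  refine hinv.congr' ?_
  filter_upwards [hne, hfin] with N h0 h1
  rw [ENNReal.inv_div (Or.inl h1.ne) (Or.inl h0)]

/-- Adding the negligible time in `B \ W` turns the exponential limit for `W` into one for the exit
time, and the ratio of means allows `θ` to serve as a common scale for all starting points. -/
lemma isValley_of_occupationConditions (hR : ∀ N, (R N).NonExplosive)
    (h : ∀ η : ∀ N, E N, (∀ N, η N ∈ W N) → OccupationConditions R W B ξ η)
    (hθ : ∀ N, 0 < θ N)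
    (hθm : ∀ᶠ N in atTop, ENNReal.ofReal (θ N) = (R N).meanOcc (B N)ᶜ (W N) (ξ N)) :
    IsValley R W B ξ θ := by
  refine (isValley_iff hR).2 ⟨hθ, fun η hη => ?_⟩
  have hne := (h η hη).eventually_meanOcc_ne_zero hR
  have hratio := (h η hη).tendsto_meanOcc_div hR
  obtain ⟨hfin, -, hattr, hT, hZ⟩ := (occupationConditions_iff hR).1 (h η hη)
  have heq : ∀ᶠ N in atTop, ∀ x : ℝ≥0∞, x / ENNReal.ofReal (θ N)
      = x / (R N).meanOcc (B N)ᶜ (W N) (η N)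
        * ((R N).meanOcc (B N)ᶜ (W N) (η N) / (R N).meanOcc (B N)ᶜ (W N) (ξ N)) := by
    filter_upwards [hne, hfin, hθm] with N h0 h1 h2 x
    rw [h2]
    exact div_eq_div_mul_div x h0 h1.ne
  refine ⟨tendsto_law_attractor_first hR hT hattr,
    (hT.add hZ).mul_of_tendsto_one hratio ?_, hZ.mul_of_tendsto_one hratio ?_⟩
  · filter_upwards [heq] with N hN ω
    rw [hN, RateMatrix.occ_univ_eq_add (W N), ENNReal.add_div]
  · filter_upwards [heq] with N hN ω using hN _

end Sequences

end Valley

end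

open Valley
theorem proposition4p4 {E : ℕ → Type*} [∀ N, Countable (E N)] [∀ N, MeasurableSpace (E N)]
    [∀ N, DiscreteMeasurableSpace (E N)]
    (R : ∀ N, RateMatrix (E N)) (hR : ∀ N, (R N).NonExplosive)
    (W B : ∀ N, Set (E N)) (hWB : ∀ N, W N ⊆ B N) (hB : ∀ N, B N ⊂ Set.univ)
    (ξ : ∀ N, E N) (hξ : ∀ N, ξ N ∈ W N) :
    (∀ θ : ℕ → ℝ, IsValley R W B ξ θ →
      ∀ η : ∀ N, E N, (∀ N, η N ∈ W N) →
        OccupationConditions R W B ξ η ∧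
        Tendsto (fun N => (R N).meanTimeSpent (η N) (B N)ᶜ (W N) / ENNReal.ofReal (θ N))
          atTop (𝓝 1)) ∧
    ((∀ η : ∀ N, E N, (∀ N, η N ∈ W N) → OccupationConditions R W B ξ η) →
      (∀ η : ∀ N, E N, (∀ N, η N ∈ W N) →
        Tendsto (fun N => (R N).meanTimeSpent (η N) (B N)ᶜ (W N)
          / (R N).meanTimeSpent (ξ N) (B N)ᶜ (W N)) atTop (𝓝 1)) ∧
      (∀ θ : ℕ → ℝ, (∀ N, 0 < θ N) →
        (∀ᶠ N in atTop, ENNReal.ofReal (θ N) = (R N).meanTimeSpent (ξ N) (B N)ᶜ (W N)) →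
        IsValley R W B ξ θ)) := by
  simp only [fun N => (hR N).meanTimeSpent_eq]
  exact ⟨fun θ h η hη => h.occupationConditions hR hξ hη,
    fun h => ⟨fun η hη => (h η hη).tendsto_meanOcc_div hR,
      fun θ hθ hθm => isValley_of_occupationConditions hR h hθ hθm⟩⟩
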